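/- Let $q$ be a prime power. A function field over $\mathbb F_{q^2}$ means an algebraic function field of one variable with full constant field $\mathbb F_{q^2}$, and $g(F)$ denotes its genus. A tower over $\mathbb F_{q^2}$ is a sequence $\mathcal E=(E_n)_{n\ge 0}$ of function fields $E_0\subsetneq E_1\subsetneq E_2\subsetneq\cdots$ over $\mathbb F_{q^2}$ such that every extension $E_{n+1}/E_n$ is finite and separable and $g(E_n)\to\infty$. For $r\ge 1$ let $B_r(E_n)$ be the number of places of $E_n/\mathbb F_{q^2}$ of degree $r$, let $$\nu_r(\mathcal E)=\lim_{n\to\infty}\frac{B_r(E_n)}{[E_n:E_0]},$$ and let $\mathcal P(\mathcal E)=\{r\ge 1:\nu_r(\mathcal E)>0\}$ be the set of positive parameters of $\mathcal E$. For every set $M\subseteq\mathbb N$ there is a tower $\mathcal E$ over $\mathbb F_{q^2}$, for which the limits $\nu_r(\mathcal E)$, $r\ge 1$, all exist, with $\mathcal P(\mathcal E)\cap M=\emptyset$. Moreover, for every finite set $N\subseteq\{1,2,3,\dots\}\setminus M$ there is such a tower with $\mathcal P(\mathcal E)=N$. -/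

import Mathlib

open Filter Topology

noncomputable section

/-- `F/k` is an algebraic function field of one variable whose full constant field is `k`. -/
structure IsFunctionFieldOver (k F : Type*) [Field k] [Field F] [Algebra k F] : Prop where
  finite_over_ratFunc : ∃ x : F, Transcendental k x ∧
    FiniteDimensional (IntermediateField.adjoin k {x}) F
  full_constants : ∀ y : F, IsAlgebraic k y → y ∈ (algebraMap k F).range

/-- A place of `F/k`, given by its valuation ring `k ⊆ 𝒪 ⊊ F`. -/
structure FFPlace (k F : Type*) [Field k] [Field F] [Algebra k F] where
  ring : ValuationSubring F
  algebraMap_mem : ∀ c : k, algebraMap k F c ∈ ring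
  ne_top : ring ≠ ⊤

namespace FFPlace

variable {k F : Type*} [Field k] [Field F] [Algebra k F]

/-- The valuation ring of a place is a `k`-algebra. -/
instance (P : FFPlace k F) : Algebra k P.ring :=
  ((algebraMap k F).codRestrict P.ring.toSubring P.algebraMap_mem).toAlgebra

/-- The degree of a place: the degree over `k` of its residue class field. -/
def degree (P : FFPlace k F) : ℕ :=
  Module.finrank k (IsLocalRing.ResidueField P.ring)

end FFPlace

section Genus

variable (k F : Type*) [Field k] [Field F] [Algebra k F]

/-- `B_r(F)`, the number of places of degree `r`. -/
def numPlaces (r : ℕ) : ℕ := Nat.card {P : FFPlace k F // P.degree = r}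

/-- Divisors of `F/k`. -/
abbrev FFDivisor := FFPlace k F →₀ ℤ

variable {k F}

/-- The degree of a divisor. -/
def FFDivisor.degree (D : FFDivisor k F) : ℤ := D.sum fun P n => n * (P.degree : ℤ)

/-- The Riemann-Roch space `L(D) = {x | v_P(x) ≥ -D(P) for all P}`. The maximal ideal of every
place of a function field is principal, and for a generator `t` the condition
`v_P(x) ≥ -D(P)` says that `x * t ^ D(P)` lies in the valuation ring (whichever `t` is chosen). -/
def FFDivisor.riemannRochSpace (D : FFDivisor k F) : Submodule k F where
  carrier := {x | ∀ (P : FFPlace k F) (t : P.ring),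
    IsLocalRing.maximalIdeal P.ring = Ideal.span {t} → x * (t : F) ^ (D P) ∈ P.ring}
  zero_mem' := fun P t _ => by simp
  add_mem' := fun {x y} hx hy P t ht => by
    simpa [add_mul] using P.ring.add_mem _ _ (hx P t ht) (hy P t ht)
  smul_mem' := fun c x hx P t ht => by
    simpa [Algebra.smul_def, mul_assoc] using
      P.ring.mul_mem _ _ (P.algebraMap_mem c) (hx P t ht)

variable (k F)

/-- The genus of `F/k`: the maximum of `deg D - ℓ(D) + 1` over all divisors `D`. -/
def ffGenus : ℤ :=
  sSup {g : ℤ | ∃ D : FFDivisor k F,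
    g = D.degree - (Module.finrank k D.riemannRochSpace : ℤ) + 1}

end Genus

/-- A tower of function fields over `k`, all of them inside the field `Ω`. -/
structure FFTower (k Ω : Type*) [Field k] [Field Ω] [Algebra k Ω] where
  field : ℕ → IntermediateField k Ω
  isFunctionField : ∀ n, IsFunctionFieldOver k (field n)
  lt_succ : ∀ n, field n < field (n + 1)
  finite_step : ∀ n, FiniteDimensional (field n)
    (IntermediateField.extendScalars (lt_succ n).le)
  separable_step : ∀ n, Algebra.IsSeparable (field n)
    (IntermediateField.extendScalars (lt_succ n).le)
  genus_tendsto : Tendsto (fun n => ffGenus k (field n)) atTop atTop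

namespace FFTower

variable {k Ω : Type*} [Field k] [Field Ω] [Algebra k Ω] (T : FFTower k Ω)

/-- The sequence `B_r(F_n) / [F_n : F_0]`. -/
def ratio (r n : ℕ) : ℝ :=
  (numPlaces k (T.field n) r : ℝ) / (IntermediateField.relfinrank (T.field 0) (T.field n) : ℝ)

/-- The invariant `ν_r`, the limit of `B_r(F_n) / [F_n : F_0]`. -/
def nu (r : ℕ) : ℝ := limUnder atTop (T.ratio r)

/-- The set of positive parameters `{r ≥ 1 | ν_r > 0}`. -/
def positiveParameters : Set ℕ := {r | 1 ≤ r ∧ 0 < T.nu r}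

end FFTower

end

noncomputable section

open IntermediateField Polynomial IsLocalRing

/-- `F` is finite over a rational function field over `k`; the constants are not restricted. -/
class IsAlgFunctionField (k F : Type*) [Field k] [Field F] [Algebra k F] : Prop where
  exists_finite : ∃ x : F, Transcendental k x ∧ FiniteDimensional k⟮x⟯ F

section FunctionField

variable {k F : Type*} [Field k] [Field F] [Algebra k F]

theorem IsFunctionFieldOver.isAlgFunctionField (h : IsFunctionFieldOver k F) :
    IsAlgFunctionField k F := ⟨h.finite_over_ratFunc⟩

theorem isTranscendenceBasis_singleton {x : F} (hx : Transcendental k x)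
    (h : Algebra.IsAlgebraic k⟮x⟯ F) : IsTranscendenceBasis k (fun _ : Unit => x) := by
  have hi : AlgebraicIndependent k (fun _ : Unit => x) :=
    algebraicIndependent_unique_type_iff.2 hx
  rw [isTranscendenceBasis_iff_algebraicIndependent_isAlgebraic]
  refine ⟨hi, ?_⟩
  rw [Set.range_const]
  exact IntermediateField.isAlgebraic_adjoin_iff_top.mp h

/-- A function field is finite over the field generated by any transcendental element. -/
theorem finiteDimensional_adjoin [IsAlgFunctionField k F] {w : F} (hw : Transcendental k w) :
    FiniteDimensional k⟮w⟯ F := by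
  obtain ⟨x, hx, hfin⟩ := IsAlgFunctionField.exists_finite (k := k) (F := F)
  have hbx := isTranscendenceBasis_singleton hx inferInstance
  have hiw : AlgebraicIndependent k (fun _ : Unit => w) :=
    algebraicIndependent_unique_type_iff.2 hw
  have hbw : IsTranscendenceBasis k (fun _ : Unit => w) := by
    apply hiw.isTranscendenceBasis_of_lift_trdeg_le_of_finite
    rw [← hbx.lift_cardinalMk_eq_trdeg]
  have halg : Algebra.IsAlgebraic k⟮w⟯ F := by
    have := hbw.isAlgebraic_field
    rwa [Set.range_const] at this
  have hxi : IsIntegral k⟮w⟯ x := (halg.isAlgebraic x).isIntegral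
  have h1 : FiniteDimensional k⟮w⟯ k⟮w⟯⟮x⟯ := IntermediateField.adjoin.finiteDimensional hxi
  have hle : k⟮x⟯ ≤ k⟮w⟯⟮x⟯.restrictScalars k := by
    rw [IntermediateField.adjoin_simple_le_iff]
    exact IntermediateField.mem_adjoin_simple_self k⟮w⟯ x
  let _ : Algebra k⟮x⟯ k⟮w⟯⟮x⟯ := (IntermediateField.inclusion hle).toRingHom.toAlgebra
  have : IsScalarTower k⟮x⟯ k⟮w⟯⟮x⟯ F := IsScalarTower.of_algebraMap_eq fun _ => rfl
  have h2 : FiniteDimensional k⟮w⟯⟮x⟯ F := FiniteDimensional.right k⟮x⟯ k⟮w⟯⟮x⟯ F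
  exact FiniteDimensional.trans k⟮w⟯ k⟮w⟯⟮x⟯ F

theorem linearIndependent_adjoin_of_polynomial {w : F} {ι : Type*} [Fintype ι] {z : ι → F}
    (h : ∀ c : ι → k[X], ∑ i, aeval w (c i) * z i = 0 → c = 0) :
    LinearIndependent k⟮w⟯ z := by
  open scoped IntermediateField.algebraAdjoinAdjoin in
  rw [← LinearIndependent.iff_fractionRing (Algebra.adjoin k {w}) k⟮w⟯,
    Fintype.linearIndependent_iff]
  intro g hg i
  have hg' : ∀ i, ∃ c : k[X], aeval w c = (g i : F) := fun i => by
    exact (Algebra.adjoin_singleton_eq_range_aeval k w).le (g i).2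
  choose c hc using hg'
  have hc0 := h c (by simpa [hc, Algebra.smul_def] using hg)
  apply Subtype.ext
  rw [← hc i, hc0]
  simp

/-- A quotient of a `k`-subalgebra `A` of `F` that is killed by multiples of `w` has dimension at
most `[F : k(w)]`. -/
theorem finrank_le_of_surjective {A V : Type*} [CommRing A] [Algebra k A] [Algebra A F]
    [IsScalarTower k A F] [AddCommGroup V] [Module k V] (φ : A →ₗ[k] V)
    (hφ : Function.Surjective φ) {w : A} (hw : algebraMap A F w ≠ 0)
    [FiniteDimensional k⟮algebraMap A F w⟯ F] (hA : Function.Injective (algebraMap A F))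
    (hφw : ∀ a, φ (w * a) = 0) :
    FiniteDimensional k V ∧ Module.finrank k V ≤ Module.finrank k⟮algebraMap A F w⟯ F := by
  have key : ∀ (m : ℕ) (b : Fin m → V), LinearIndependent k b →
      m ≤ Module.finrank k⟮algebraMap A F w⟯ F := by
    intro m b hb
    choose z hz using fun i => hφ (b i)
    have hli : LinearIndependent k⟮algebraMap A F w⟯ (fun i => algebraMap A F (z i)) := by
      apply linearIndependent_adjoin_of_polynomial
      have main : ∀ n : ℕ, ∀ c : Fin m → k[X], (∀ i, (c i).degree < n) →
          ∑ i, aeval w (c i) * z i = 0 → c = 0 := by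
        intro n
        induction n with
        | zero =>
          intro c hc _
          funext i
          simpa [Polynomial.degree_lt_iff_coeff_zero, Polynomial.ext_iff] using hc i
        | succ n ih =>
          intro c hc hs
          have hdec : ∀ i, aeval w (c i) * z i
              = w * (aeval w (c i).divX * z i) + (c i).coeff 0 • z i := by
            intro i
            conv_lhs => rw [← Polynomial.divX_mul_X_add (c i)]
            simp [Algebra.smul_def]
            ring
          have hs' := hs
          simp_rw [hdec, Finset.sum_add_distrib, ← Finset.mul_sum] at hs'
          have h0 : ∑ i, (c i).coeff 0 • b i = 0 := by
            have := congrArg φ hs'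
            simpa [hφw, hz] using this
          have hc0 : ∀ i, (c i).coeff 0 = 0 := Fintype.linearIndependent_iff.1 hb _ h0
          have hdiv : (fun i => (c i).divX) = 0 := by
            apply ih
            · intro i
              by_cases hci : c i = 0
              · simp [hci]
              · have h1 := Polynomial.degree_divX_lt hci
                have h2 := hc i
                by_cases hd : (c i).divX = 0
                · simp [hd]
                rw [Polynomial.degree_eq_natDegree hci] at h1 h2
                rw [Polynomial.degree_eq_natDegree hd] at h1 ⊢
                norm_cast at *
                omega
            · simp only [hc0, zero_smul, Finset.sum_const_zero, add_zero] at hs'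
              apply hA
              have := congrArg (algebraMap A F) hs'
              rw [map_mul, map_zero, mul_eq_zero] at this
              simpa using this.resolve_left hw
          funext i
          rw [← Polynomial.divX_mul_X_add (c i), hc0, show (c i).divX = 0 from congrFun hdiv i]
          simp
      intro c hc
      apply main (∑ i, (c i).natDegree + 1) c
      · intro i
        refine Polynomial.degree_le_natDegree.trans_lt ?_
        norm_cast
        exact Nat.lt_succ_of_le
          (Finset.single_le_sum (f := fun i => (c i).natDegree) (fun _ _ => Nat.zero_le _)
            (Finset.mem_univ i))
      · apply hA
        rw [map_sum, map_zero, ← hc]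
        simp [Polynomial.aeval_algebraMap_apply]
    simpa using hli.fintype_card_le_finrank
  have hfin : FiniteDimensional k V := by
    by_contra hV
    obtain ⟨s, hs⟩ := exists_finset_linearIndependent_of_le_rank
      (R := k) (M := V) (n := Module.finrank k⟮algebraMap A F w⟯ F + 1) (by
        by_contra hlt
        exact hV (Module.rank_lt_aleph0_iff.1 ((not_le.1 hlt).trans (Cardinal.natCast_lt_aleph0))))
    have := key _ (fun i => (s.equivFin.symm i : V)) (hs.2.comp _ (s.equivFin.symm.injective))
    omega
  refine ⟨hfin, ?_⟩
  exact key _ _ (Module.finBasis k V).linearIndependent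

end FunctionField

namespace FFPlace

variable {k F : Type*} [Field k] [Field F] [Algebra k F] (P : FFPlace k F)

instance : IsScalarTower k P.ring F := IsScalarTower.of_algebraMap_eq fun _ => rfl

theorem ext_ring {P Q : FFPlace k F} (h : P.ring = Q.ring) : P = Q := by
  cases P; cases Q; simp_all

theorem aeval_mem {z : F} (hz : z ∈ P.ring) (g : k[X]) : aeval z g ∈ P.ring := by
  rw [aeval_eq_sum_range]
  refine sum_mem fun i _ => ?_
  rw [Algebra.smul_def]
  exact mul_mem (P.algebraMap_mem _) (pow_mem hz _)

theorem mem_of_isAlgebraic {z : F} (hz : IsAlgebraic k z) : z ∈ P.ring := by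
  by_contra h
  have hz0 : z ≠ 0 := fun h0 => h (h0 ▸ zero_mem _)
  have h1 : z⁻¹ ∈ P.ring := (P.ring.mem_or_inv_mem z).resolve_left h
  refine h ?_
  have hi : z⁻¹⁻¹ ∈ Algebra.adjoin k {z⁻¹} := by
    have hzi : IsIntegral k z⁻¹ := hz.isIntegral.inv
    exact hzi.inv_mem_adjoin
  rw [inv_inv, Algebra.adjoin_singleton_eq_range_aeval] at hi
  obtain ⟨g, hg⟩ := hi
  rw [← hg]
  exact P.aeval_mem h1 g

theorem transcendental_of_mem_nonunits {z : F} (hz0 : z ≠ 0) (hz : z ∈ P.ring.nonunits) :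
    Transcendental k z := by
  intro ha
  have h1 : z⁻¹ ∈ P.ring := P.mem_of_isAlgebraic ha.inv
  rw [ValuationSubring.mem_nonunits_iff] at hz
  have h2 := (P.ring.valuation_le_one_iff _).2 h1
  rw [map_inv₀] at h2
  have := one_lt_inv₀ (zero_lt_iff.2 ((P.ring.valuation).ne_zero_iff.2 hz0)) |>.2 hz
  exact absurd h2 (not_le.2 this)

theorem exists_mem_nonunits : ∃ w : F, w ≠ 0 ∧ w ∈ P.ring.nonunits := by
  obtain ⟨z, hz⟩ : ∃ z, z ∉ P.ring := by
    by_contra! h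
    exact P.ne_top (by ext; simp [h])
  have hz0 : z ≠ 0 := fun h0 => hz (h0 ▸ zero_mem _)
  exact ⟨z⁻¹, inv_ne_zero hz0, (P.ring.inv_mem_nonunits_iff).2 (Or.inr hz)⟩

section

variable [IsAlgFunctionField k F]

theorem finite_quotient_span {w : P.ring} (hw0 : w ≠ 0) (hw : w ∈ maximalIdeal P.ring) :
    FiniteDimensional k (P.ring ⧸ Ideal.span {w}) := by
  have hw0' : (w : F) ≠ 0 := by simpa using hw0
  have ht : Transcendental k (w : F) :=
    P.transcendental_of_mem_nonunits hw0' (ValuationSubring.mem_nonunits_iff_exists_mem_maximalIdeal.2 ⟨w.2, hw⟩)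
  have : FiniteDimensional k⟮algebraMap P.ring F w⟯ F := finiteDimensional_adjoin ht
  exact (finrank_le_of_surjective (k := k) (F := F) (w := w) (Ideal.Quotient.mkₐ k (Ideal.span {w})).toLinearMap
    Ideal.Quotient.mk_surjective hw0' Subtype.val_injective
    (fun a => Ideal.Quotient.eq_zero_iff_mem.2 (Ideal.mem_span_singleton'.2 ⟨a, mul_comm _ _⟩))).1

instance isNoetherianRing : IsNoetherianRing P.ring := by
  obtain ⟨w, hw0, hw⟩ := P.exists_mem_nonunits
  obtain ⟨hwm, hwm'⟩ := ValuationSubring.mem_nonunits_iff_exists_mem_maximalIdeal.1 hw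
  rw [isNoetherianRing_iff_ideal_fg]
  intro I
  by_cases hI : I = ⊥
  · subst hI; exact Submodule.fg_bot
  obtain ⟨a, haI, ha0⟩ := Submodule.exists_mem_ne_zero_of_ne_bot hI
  set b : P.ring := a * ⟨w, hwm⟩ with hb
  have hb0 : b ≠ 0 := mul_ne_zero ha0 (fun h => hw0 (congrArg Subtype.val h))
  have hbI : b ∈ I := I.mul_mem_right _ haI
  have := P.finite_quotient_span hb0 (Ideal.mul_mem_left _ _ hwm')
  have hN : IsNoetherian P.ring (P.ring ⧸ Ideal.span {b}) := isNoetherian_of_tower k inferInstance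
  refine Submodule.fg_of_fg_map_of_fg_inf_ker (Submodule.mkQ (Ideal.span {b})) (hN.noetherian _) ?_
  rw [Submodule.ker_mkQ, inf_eq_right.2 ((Ideal.span_singleton_le_iff_mem _).2 hbI)]
  exact ⟨{b}, by simp⟩

instance isDiscreteValuationRing : IsDiscreteValuationRing P.ring := by
  have hf : ¬ IsField P.ring := by
    obtain ⟨w, hw0, hw⟩ := P.exists_mem_nonunits
    obtain ⟨hwm, hwm'⟩ := ValuationSubring.mem_nonunits_iff_exists_mem_maximalIdeal.1 hw
    rw [isField_iff_maximalIdeal_eq]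
    intro h
    rw [h, Ideal.mem_bot] at hwm'
    exact hw0 (congrArg Subtype.val hwm')
  exact ((IsDiscreteValuationRing.TFAE P.ring hf).out 1 0).1
    (inferInstance : ValuationRing P.ring)

instance finite_residueField : FiniteDimensional k (ResidueField P.ring) := by
  obtain ⟨t, ht⟩ := IsDiscreteValuationRing.exists_irreducible P.ring
  have := P.finite_quotient_span ht.ne_zero
    ((IsDiscreteValuationRing.irreducible_iff_uniformizer t).1 ht ▸ Ideal.mem_span_singleton_self t)
  rw [← (IsDiscreteValuationRing.irreducible_iff_uniformizer t).1 ht] at this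
  exact this

theorem degree_pos : 0 < P.degree := Module.finrank_pos

/-- The absolute value of a place, normalised so that uniformizers have absolute value `1 / 2`. -/
def abv : AbsoluteValue F ℝ :=
  (IsDiscreteValuationRing.maximalIdeal P.ring).adicAbv (K := F) one_lt_two

theorem abv_nonarch (a b : F) : P.abv (a + b) ≤ max (P.abv a) (P.abv b) :=
  (IsDiscreteValuationRing.maximalIdeal P.ring).isNonarchimedean_adicAbv one_lt_two a b

theorem abv_coe_le_one (a : P.ring) : P.abv a ≤ 1 :=
  (IsDiscreteValuationRing.maximalIdeal P.ring).adicAbv_coe_le_one one_lt_two a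

theorem abv_coe_lt_one_iff (a : P.ring) : P.abv a < 1 ↔ a ∈ maximalIdeal P.ring :=
  (IsDiscreteValuationRing.maximalIdeal P.ring).adicAbv_coe_lt_one_iff one_lt_two a

theorem abv_le_one_iff {z : F} : P.abv z ≤ 1 ↔ z ∈ P.ring := by
  refine ⟨fun h => ?_, fun h => P.abv_coe_le_one ⟨z, h⟩⟩
  by_contra hz
  have hz0 : z ≠ 0 := fun h0 => hz (h0 ▸ zero_mem _)
  obtain ⟨h1, h2⟩ := ValuationSubring.mem_nonunits_iff_exists_mem_maximalIdeal.1
    ((P.ring.inv_mem_nonunits_iff).2 (Or.inr hz))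
  have h3 := (P.abv_coe_lt_one_iff _).2 h2
  rw [map_inv₀] at h3
  exact absurd ((inv_lt_one₀ (P.abv.pos hz0)).1 h3) (not_lt.2 h)

theorem abv_lt_one_iff {z : F} : P.abv z < 1 ↔ z ∈ P.ring.nonunits := by
  rw [ValuationSubring.mem_nonunits_iff_exists_mem_maximalIdeal]
  refine ⟨fun h => ?_, fun ⟨h, h'⟩ => (P.abv_coe_lt_one_iff ⟨z, h⟩).2 h'⟩
  have hz := P.abv_le_one_iff.1 h.le
  exact ⟨hz, (P.abv_coe_lt_one_iff ⟨z, hz⟩).1 h⟩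

theorem abv_uniformizer {t : P.ring} (ht : maximalIdeal P.ring = Ideal.span {t}) :
    P.abv (t : F) = 2⁻¹ := by
  have ht0 : t ≠ 0 := ((IsDiscreteValuationRing.irreducible_iff_uniformizer t).2 ht).ne_zero
  have h := (IsDiscreteValuationRing.maximalIdeal P.ring).intValuation_singleton ht0 ht
  have h1 : P.abv (t : F) = (IsDiscreteValuationRing.maximalIdeal P.ring).intAdicAbv one_lt_two t :=
    (IsDiscreteValuationRing.maximalIdeal P.ring).adicAbv_of_algebraMap one_lt_two t
  rw [h1]
  change ((WithZeroMulInt.toNNReal two_ne_zero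
    ((IsDiscreteValuationRing.maximalIdeal P.ring).intValuation t) : NNReal) : ℝ) = _
  rw [h, WithZeroMulInt.toNNReal_neg_apply _ (by simp)]
  change (((2 : NNReal) ^ (-1 : ℤ) : NNReal) : ℝ) = _
  simp

theorem exists_uniformizer : ∃ t : P.ring, maximalIdeal P.ring = Ideal.span {t} :=
  (IsDiscreteValuationRing.exists_irreducible P.ring).imp fun t ht =>
    (IsDiscreteValuationRing.irreducible_iff_uniformizer t).1 ht

theorem exists_abv_eq_zpow {z : F} (hz : z ≠ 0) : ∃ a : ℤ, P.abv z = 2 ^ a := by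
  obtain ⟨t, ht⟩ := P.exists_uniformizer
  obtain ⟨n, u, hu⟩ := IsDiscreteValuationRing.exists_units_eq_smul_zpow_of_irreducible
    ((IsDiscreteValuationRing.irreducible_iff_uniformizer t).2 ht) hz
  have hu1 : P.abv (u : P.ring) = 1 := by
    refine le_antisymm (P.abv_coe_le_one _) (not_lt.1 fun h => ?_)
    exact (mem_maximalIdeal _).1 ((P.abv_coe_lt_one_iff _).1 h) u.isUnit
  refine ⟨-n, ?_⟩
  rw [hu, Units.smul_def, Algebra.smul_def, map_mul, map_zpow₀]
  erw [hu1, P.abv_uniformizer ht]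
  simp

theorem mul_uniformizer_zpow_mem_iff {t : P.ring} (ht : maximalIdeal P.ring = Ideal.span {t})
    {z : F} {a : ℤ} : z * (t : F) ^ a ∈ P.ring ↔ P.abv z ≤ 2 ^ a := by
  rw [← P.abv_le_one_iff, map_mul, map_zpow₀, P.abv_uniformizer ht, inv_zpow,
    ← div_eq_mul_inv, div_le_one (by positivity)]

theorem abv_algebraMap {c : k} (hc : c ≠ 0) : P.abv (algebraMap k F c) = 1 := by
  have h1 := P.abv_le_one_iff.2 (P.algebraMap_mem c)
  have h2 := P.abv_le_one_iff.2 (P.algebraMap_mem c⁻¹)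
  rw [map_inv₀, map_inv₀] at h2
  exact le_antisymm h1 ((inv_le_one₀ (P.abv.pos (by simpa using hc))).1 h2)

theorem abv_isNontrivial : P.abv.IsNontrivial := by
  obtain ⟨w, hw0, hw⟩ := P.exists_mem_nonunits
  exact ⟨w, hw0, (P.abv_lt_one_iff.2 hw).ne⟩

theorem eq_of_abv_isEquiv {P Q : FFPlace k F} (h : P.abv.IsEquiv Q.abv) : P = Q := by
  apply ext_ring
  ext z
  rw [← P.abv_le_one_iff, ← Q.abv_le_one_iff, h.le_one_iff]

theorem abv_add_eq_left {a b : F} (h : P.abv b < P.abv a) : P.abv (a + b) = P.abv a := by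
  refine le_antisymm ((P.abv_nonarch a b).trans (max_le le_rfl h.le)) ?_
  have := P.abv_nonarch (a + b) (-b)
  rw [add_neg_cancel_right, map_neg_eq_map] at this
  rcases le_max_iff.1 this with h1 | h1
  · exact h1
  · exact absurd h (not_lt.2 h1)

/-- Weak approximation. -/
theorem exists_forall_abv_sub_lt (S : Finset (FFPlace k F)) (a : FFPlace k F → F) {ε : ℝ}
    (hε : 0 < ε) : ∃ z : F, ∀ P ∈ S, P.abv (z - a P) < ε := by
  have hd := AbsoluteValue.denseRange_algebraMap_pi (v := fun P : S => P.1.abv)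
    (fun P => P.1.abv_isNontrivial)
    (fun P Q hPQ h => hPQ (Subtype.ext (eq_of_abv_isEquiv h)))
  obtain ⟨z, hz⟩ := (Metric.denseRange_iff.1 hd) (fun P => (WithAbs.equiv P.1.abv).symm (a P.1)) ε hε
  refine ⟨z, fun P hP => ?_⟩
  have := (dist_pi_lt_iff hε).1 hz ⟨P, hP⟩
  rw [dist_comm, dist_eq_norm] at this
  exact this

end

end FFPlace

section DegreeBound

variable {k F : Type*} [Field k] [Field F] [Algebra k F] [IsAlgFunctionField k F]

namespace FFPlace

variable (P : FFPlace k F)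

theorem finrank_quotient_uniformizer_pow {t : P.ring}
    (ht : maximalIdeal P.ring = Ideal.span {t}) (n : ℕ) :
    FiniteDimensional k (P.ring ⧸ Ideal.span {t ^ n}) ∧
      Module.finrank k (P.ring ⧸ Ideal.span {t ^ n}) = n * P.degree := by
  have ht0 : t ≠ 0 := ((IsDiscreteValuationRing.irreducible_iff_uniformizer t).2 ht).ne_zero
  induction n with
  | zero =>
    have : Subsingleton (P.ring ⧸ Ideal.span {t ^ 0}) :=
      Ideal.Quotient.subsingleton_iff.2 (by simp)
    exact ⟨inferInstance, by rw [Module.finrank_zero_of_subsingleton, zero_mul]⟩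
  | succ n ih =>
    have hfin : FiniteDimensional k (P.ring ⧸ Ideal.span {t ^ (n + 1)}) :=
      P.finite_quotient_span (pow_ne_zero _ ht0) (by
        rw [ht, Ideal.mem_span_singleton]; exact dvd_pow_self t (by simp))
    refine ⟨hfin, ?_⟩
    have hle : Ideal.span {t ^ (n + 1)} ≤ Ideal.span {t ^ n} :=
      Ideal.span_singleton_le_span_singleton.2 (pow_dvd_pow _ (by simp))
    let π : (P.ring ⧸ Ideal.span {t ^ (n + 1)}) →ₗ[k] (P.ring ⧸ Ideal.span {t ^ n}) :=
      (Ideal.Quotient.factorₐ k hle).toLinearMap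
    let ψ : (P.ring ⧸ maximalIdeal P.ring) →ₗ[k] (P.ring ⧸ Ideal.span {t ^ (n + 1)}) :=
      (Submodule.mapQ (maximalIdeal P.ring) (Ideal.span {t ^ (n + 1)})
        (LinearMap.mulLeft P.ring (t ^ n)) (by
          intro a ha
          rw [ht, Ideal.mem_span_singleton] at ha
          simp only [Submodule.mem_comap, LinearMap.mulLeft_apply, Ideal.mem_span_singleton]
          rw [pow_succ]
          exact mul_dvd_mul_left _ ha)).restrictScalars k
    have hψ : Function.Injective ψ := by
      rw [injective_iff_map_eq_zero]
      intro a
      obtain ⟨a, rfl⟩ := Ideal.Quotient.mk_surjective a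
      intro ha
      have h1 : Ideal.Quotient.mk (Ideal.span {t ^ (n + 1)}) (t ^ n * a) = 0 := ha
      rw [Ideal.Quotient.eq_zero_iff_mem, Ideal.mem_span_singleton, pow_succ,
        mul_dvd_mul_iff_left (pow_ne_zero _ ht0)] at h1
      rw [Ideal.Quotient.eq_zero_iff_mem, ht, Ideal.mem_span_singleton]
      exact h1
    have hπ : Function.Surjective π := Ideal.Quotient.factor_surjective hle
    have hker : LinearMap.ker π = LinearMap.range ψ := by
      ext a
      obtain ⟨a, rfl⟩ := Ideal.Quotient.mk_surjective a
      have h1 : π (Ideal.Quotient.mk _ a) = Ideal.Quotient.mk _ a := rfl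
      rw [LinearMap.mem_ker, h1, Ideal.Quotient.eq_zero_iff_mem, Ideal.mem_span_singleton]
      constructor
      · rintro ⟨b, rfl⟩
        exact ⟨Ideal.Quotient.mk _ b, rfl⟩
      · rintro ⟨b, hb⟩
        obtain ⟨b, rfl⟩ := Ideal.Quotient.mk_surjective b
        have h2 : Ideal.Quotient.mk (Ideal.span {t ^ (n + 1)}) (t ^ n * b)
          = Ideal.Quotient.mk _ a := hb
        rw [Ideal.Quotient.eq, Ideal.mem_span_singleton] at h2
        have h3 : t ^ n ∣ t ^ n * b - a := (pow_dvd_pow _ (by simp)).trans h2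
        exact (dvd_sub_right (dvd_mul_right _ _)).1 h3
    have h := LinearMap.finrank_range_add_finrank_ker π
    rw [hker, LinearMap.finrank_range_of_inj hψ, LinearMap.range_eq_top.2 hπ, finrank_top, ih.2] at h
    rw [← h, add_mul, one_mul]
    rfl

end FFPlace

/-- The elements of `F` that are integral at all places of `S`. -/
def semilocalRing (S : Finset (FFPlace k F)) : Subalgebra k F where
  carrier := {z | ∀ P ∈ S, z ∈ P.ring}
  mul_mem' ha hb P hP := mul_mem (ha P hP) (hb P hP)
  add_mem' ha hb P hP := add_mem (ha P hP) (hb P hP)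
  algebraMap_mem' c P _ := P.algebraMap_mem c

/-- An effective divisor bounded by the zeros of `w` has degree at most `[F : k(w)]`. -/
theorem FFDivisor.degree_le_finrank (D : FFDivisor k F) (hD : ∀ P, 0 ≤ D P) {w : F}
    (hw : Transcendental k w) (h : ∀ P ∈ D.support, P.abv w ≤ 2 ^ (-D P)) :
    D.degree ≤ Module.finrank k⟮w⟯ F := by
  choose t ht using fun P : FFPlace k F => P.exists_uniformizer
  let V := ∀ P : D.support, P.1.ring ⧸ Ideal.span {t P.1 ^ (D P.1).toNat}
  let φ : semilocalRing D.support →ₗ[k] V := LinearMap.pi fun P =>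
    (Ideal.Quotient.mkₐ k (Ideal.span {t P.1 ^ (D P.1).toNat})).toLinearMap ∘ₗ
      ({ toFun := fun z => ⟨z.1, z.2 P.1 P.2⟩
         map_add' := fun _ _ => rfl
         map_smul' := fun c z => by
          apply Subtype.ext
          simp only [Algebra.smul_def]
          rfl } : semilocalRing D.support →ₗ[k] P.1.ring)
  have hmem : ∀ (P : FFPlace k F) (a : P.ring), a ∈ Ideal.span {t P ^ (D P).toNat} ↔
      P.abv a ≤ 2 ^ (-D P) := by
    intro P a
    have h1 := P.mul_uniformizer_zpow_mem_iff (ht P) (z := a) (a := -D P)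
    rw [← h1, Ideal.mem_span_singleton]
    have ht0 : (t P : F) ≠ 0 := by
      simpa using ((IsDiscreteValuationRing.irreducible_iff_uniformizer _).2 (ht P)).ne_zero
    have hz : (t P : F) ^ (-D P) = ((t P : F) ^ (D P).toNat)⁻¹ := by
      rw [zpow_neg, ← zpow_natCast, Int.toNat_of_nonneg (hD P)]
    rw [hz]
    constructor
    · rintro ⟨b, rfl⟩
      convert b.2 using 1
      push_cast
      field_simp
    · intro hb
      refine ⟨⟨_, hb⟩, ?_⟩
      apply Subtype.ext
      push_cast
      field_simp
  have hφ : Function.Surjective φ := by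
    intro v
    choose a ha using fun P : D.support => Ideal.Quotient.mk_surjective (v P)
    classical
    obtain ⟨M, hM⟩ : ∃ M : ℤ, ∀ P ∈ D.support, D P ≤ M := by
      obtain ⟨M, hM⟩ := (D.support.image D).bddAbove
      exact ⟨M, fun P hP => hM (by simpa using ⟨P, by simpa using hP, rfl⟩)⟩
    obtain ⟨z, hz⟩ := FFPlace.exists_forall_abv_sub_lt D.support
      (fun P => if hP : P ∈ D.support then (a ⟨P, hP⟩ : F) else 0)
      (ε := 2 ^ (-max M 0)) (by positivity)
    have hz' : ∀ P : D.support, P.1.abv (z - a P) ≤ 2 ^ (-D P.1) := by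
      intro P
      have := hz P.1 P.2
      rw [dif_pos P.2] at this
      refine this.le.trans (zpow_le_zpow_right₀ one_le_two ?_)
      have := hM P.1 P.2
      omega
    have hzm : ∀ P ∈ D.support, z ∈ P.ring := by
      intro P hP
      have h1 : z - a ⟨P, hP⟩ ∈ P.ring := by
        rw [← P.abv_le_one_iff]
        refine (hz' ⟨P, hP⟩).trans (zpow_le_one_of_nonpos₀ one_le_two ?_)
        have := hD P
        simp only
        omega
      simpa using add_mem h1 (a ⟨P, hP⟩).2
    refine ⟨⟨z, hzm⟩, ?_⟩
    funext P
    rw [← ha P]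
    change Ideal.Quotient.mk _ _ = _
    rw [Ideal.Quotient.eq, hmem]
    exact hz' P
  have hw0 : w ≠ 0 := fun h0 => hw (h0 ▸ isAlgebraic_zero)
  have hwA : ∀ P ∈ D.support, w ∈ P.ring := fun P hP => by
    rw [← P.abv_le_one_iff]
    refine (h P hP).trans (zpow_le_one_of_nonpos₀ one_le_two ?_)
    have := hD P
    omega
  let w' : semilocalRing D.support := ⟨w, hwA⟩
  have hF : FiniteDimensional k⟮algebraMap (semilocalRing D.support) F w'⟯ F :=
    finiteDimensional_adjoin hw
  have main := (finrank_le_of_surjective (k := k) (F := F) φ hφ (w := w') hw0 Subtype.val_injective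
    (fun a => by
      funext P
      change Ideal.Quotient.mk _ _ = 0
      rw [Ideal.Quotient.eq_zero_iff_mem, hmem]
      change P.1.abv (w * a) ≤ _
      rw [map_mul]
      have h2 := P.1.abv_le_one_iff.2 (a.2 P.1 P.2)
      exact (mul_le_of_le_one_right (P.1.abv.nonneg _) h2).trans (h P.1 P.2))).2
  have hV : (Module.finrank k V : ℤ) = D.degree := by
    have := fun P : D.support => (P.1.finrank_quotient_uniformizer_pow (ht P.1) (D P.1).toNat).1
    rw [show Module.finrank k V = _ from Module.finrank_pi_fintype k, FFDivisor.degree,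
      Finsupp.sum, ← Finset.sum_coe_sort D.support, Nat.cast_sum]
    refine Finset.sum_congr rfl fun P _ => ?_
    rw [(P.1.finrank_quotient_uniformizer_pow (ht P.1) (D P.1).toNat).2]
    push_cast
    rw [Int.toNat_of_nonneg (hD _)]
  rw [← hV]
  exact_mod_cast main

end DegreeBound

section PlaceCounting

variable {k F : Type*} [Field k] [Field F] [Algebra k F]

theorem exists_place_mem_nonunits {w : F} (hw : Transcendental k w) :
    ∃ P : FFPlace k F, w ∈ P.ring.nonunits := by
  let A := (Algebra.adjoin k {w}).toSubring
  let w' : A := ⟨w, Algebra.self_mem_adjoin_singleton k w⟩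
  have hI : Ideal.span {w'} ≠ ⊤ := by
    intro h
    rw [Ideal.eq_top_iff_one, Ideal.mem_span_singleton] at h
    obtain ⟨⟨b, hb⟩, h⟩ := h
    obtain ⟨g, rfl⟩ := (Algebra.adjoin_singleton_eq_range_aeval k w).le hb
    have h1 : (1 : F) = w * aeval w g := congrArg Subtype.val h
    refine hw ⟨X * g - 1, fun h0 => ?_, by simp [← h1]⟩
    have := congrArg (eval 0) h0
    simp at this
  obtain ⟨B, hAB, hB⟩ := Ideal.image_subset_nonunits_valuationSubring _ hI
  have hwB : w ∈ B.nonunits := hB ⟨w', Ideal.mem_span_singleton_self _, rfl⟩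
  have hw0 : w ≠ 0 := fun h0 => hw (h0 ▸ isAlgebraic_zero)
  refine ⟨⟨B, fun c => hAB (Subalgebra.algebraMap_mem _ c), fun h => ?_⟩, hwB⟩
  have h1 := B.inv_mem_nonunits_iff (x := w⁻¹)
  rw [inv_inv] at h1
  rcases h1.1 hwB with h2 | h2
  · exact hw0 (by simpa using h2)
  · exact h2 (h ▸ ValuationSubring.mem_top _)

theorem isAlgebraic_of_forall_mem {z : F} (hz : ∀ P : FFPlace k F, z ∈ P.ring) :
    IsAlgebraic k z := by
  by_contra h
  obtain ⟨P, hP⟩ := exists_place_mem_nonunits (k := k) (w := z⁻¹) (fun h' => h (by simpa using h'.inv))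
  rcases (P.ring.inv_mem_nonunits_iff).1 hP with h0 | h0
  · exact h (h0 ▸ isAlgebraic_zero)
  · exact h0 (hz P)

theorem transcendental_aeval {x : F} (hx : Transcendental k x) {g : k[X]} (hg : 0 < g.natDegree) :
    Transcendental k (aeval x g) :=
  hx.aeval g hg.ne' (mem_nonZeroDivisors_of_ne_zero (by
    rintro h
    rw [leadingCoeff_eq_zero] at h
    simp [h] at hg))

theorem finrank_adjoin_aeval_le {x : F} {g : k[X]} (hg : 0 < g.natDegree) :
    Module.finrank k⟮aeval x g⟯ F ≤ g.natDegree * Module.finrank k⟮x⟯ F := by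
  set w := aeval x g with hw
  have hle : k⟮w⟯ ≤ k⟮x⟯ := by
    rw [IntermediateField.adjoin_simple_le_iff, hw]
    exact IntermediateField.algebra_adjoin_le_adjoin _ _ (aeval_mem_adjoin_singleton k x)
  rw [← IntermediateField.relfinrank_mul_finrank_top hle]
  refine Nat.mul_le_mul_right _ ?_
  rw [IntermediateField.relfinrank_eq_finrank_of_le hle]
  have hext : IntermediateField.extendScalars hle = k⟮w⟯⟮x⟯ := by
    apply le_antisymm
    · intro z hz
      have hz' : z ∈ k⟮x⟯ := hz
      have : k⟮x⟯ ≤ k⟮w⟯⟮x⟯.restrictScalars k := by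
        rw [IntermediateField.adjoin_simple_le_iff]
        exact IntermediateField.mem_adjoin_simple_self k⟮w⟯ x
      exact this hz'
    · rw [IntermediateField.adjoin_simple_le_iff]
      exact IntermediateField.mem_adjoin_simple_self k x
  rw [hext]
  let G : k⟮w⟯[X] := g.map (algebraMap k k⟮w⟯) - C (AdjoinSimple.gen k w)
  have hGd : G.natDegree = g.natDegree := by
    rw [Polynomial.natDegree_sub_C, Polynomial.natDegree_map]
  have hG0 : G ≠ 0 := fun h => by rw [h] at hGd; simp at hGd; omega
  have hGx : aeval x G = 0 := by
    simp [G, hw]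
  have hint : IsIntegral k⟮w⟯ x := isAlgebraic_iff_isIntegral.1 ⟨G, hG0, hGx⟩
  rw [IntermediateField.adjoin.finrank hint, ← hGd]
  exact Polynomial.natDegree_le_of_dvd (minpoly.dvd _ _ hGx) hG0

variable [IsAlgFunctionField k F]

theorem FFPlace.abv_aeval_le (P : FFPlace k F) {x : F} (hx : 1 ≤ P.abv x) {g : k[X]} {d : ℕ}
    (hd : g.natDegree ≤ d) : P.abv (aeval x g) ≤ P.abv x ^ d := by
  rw [aeval_eq_sum_range]
  refine Finset.sum_induction _ (fun z => P.abv z ≤ P.abv x ^ d)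
    (fun a b ha hb => (P.abv_nonarch a b).trans (max_le ha hb)) (by simp) fun i hi => ?_
  rw [Algebra.smul_def, map_mul, map_pow]
  refine (mul_le_of_le_one_left (by positivity) (P.abv_le_one_iff.2 (P.algebraMap_mem _))).trans ?_
  have := Finset.mem_range.1 hi
  exact pow_le_pow_right₀ hx (by omega)

theorem FFPlace.abv_aeval_of_one_lt (P : FFPlace k F) {x : F} (hx : 1 < P.abv x) {g : k[X]}
    (hg : g ≠ 0) : P.abv (aeval x g) = P.abv x ^ g.natDegree := by
  have hlead : P.abv (aeval x (C g.leadingCoeff * X ^ g.natDegree)) = P.abv x ^ g.natDegree := by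
    simp [P.abv_algebraMap (leadingCoeff_ne_zero.2 hg)]
  rw [← g.eraseLead_add_C_mul_X_pow, add_comm, map_add, P.abv_add_eq_left]
  · rw [hlead, g.eraseLead_add_C_mul_X_pow.symm.trans (add_comm _ _) |>.symm]
  · rw [hlead]
    by_cases h0 : g.eraseLead = 0
    · rw [h0, map_zero, map_zero]
      positivity
    · have h1 := g.eraseLead_natDegree_le
      have h2 : 0 < g.natDegree := by
        by_contra h
        rw [not_lt, Nat.le_zero] at h
        rw [eq_C_of_natDegree_eq_zero h, eraseLead_C] at h0
        exact h0 rfl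
      exact (P.abv_aeval_le hx.le h1).trans_lt (pow_lt_pow_right₀ hx (by omega))

theorem sum_degree_le_finrank {w : F} (hw : Transcendental k w) (S : Finset (FFPlace k F))
    (hS : ∀ P ∈ S, P.abv w < 1) : ∑ P ∈ S, P.degree ≤ Module.finrank k⟮w⟯ F := by
  classical
  let D : FFDivisor k F := Finsupp.indicator S (fun _ _ => 1)
  have hD : ∀ P ∈ S, D P = 1 := fun P hP => Finsupp.indicator_of_mem hP _
  have hsupp : D.support ⊆ S := Finsupp.support_indicator_subset _ _
  have h := D.degree_le_finrank (w := w) (fun P => by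
    by_cases hP : P ∈ S
    · rw [hD P hP]; exact zero_le_one
    · exact (Finsupp.indicator_of_notMem hP _).ge) hw (fun P hP => by
      have hw0 : w ≠ 0 := fun h0 => hw (h0 ▸ isAlgebraic_zero)
      obtain ⟨a, ha⟩ := P.exists_abv_eq_zpow hw0
      have h1 := hS P (hsupp hP)
      rw [hD P (hsupp hP), ha]
      rw [ha, zpow_lt_one_iff_right₀ one_lt_two] at h1
      exact zpow_le_zpow_right₀ one_le_two (by omega))
  have hdeg : D.degree = ∑ P ∈ S, (P.degree : ℤ) := by
    rw [FFDivisor.degree, Finsupp.sum_of_support_subset _ hsupp _ (by simp)]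
    exact Finset.sum_congr rfl fun P hP => by rw [hD P hP, one_mul]
  rw [hdeg] at h
  exact_mod_cast h

theorem finite_zeros {w : F} (hw : Transcendental k w) :
    {P : FFPlace k F | P.abv w < 1}.Finite ∧
      {P : FFPlace k F | P.abv w < 1}.ncard ≤ Module.finrank k⟮w⟯ F := by
  have key : ∀ S : Finset (FFPlace k F), ↑S ⊆ {P : FFPlace k F | P.abv w < 1} →
      S.card ≤ Module.finrank k⟮w⟯ F := by
    intro S hS
    refine le_trans ?_ (sum_degree_le_finrank hw S hS)
    rw [Finset.card_eq_sum_ones]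
    exact Finset.sum_le_sum fun P _ => P.degree_pos
  have hfin : {P : FFPlace k F | P.abv w < 1}.Finite := by
    by_contra hinf
    obtain ⟨S, hS, hc⟩ := Set.Infinite.exists_subset_card_eq hinf (Module.finrank k⟮w⟯ F + 1)
    have := key S hS
    omega
  refine ⟨hfin, ?_⟩
  rw [Set.ncard_eq_toFinset_card _ hfin]
  exact key _ (by simp)

theorem FFPlace.abv_pow_card_sub_lt_one [Finite k] (P : FFPlace k F) {z : F} (hz : z ∈ P.ring) :
    P.abv (z ^ Nat.card k ^ P.degree - z) < 1 := by
  have hfin : Finite (ResidueField P.ring) := Module.finite_of_finite k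
  have := Fintype.ofFinite (ResidueField P.ring)
  have h := FiniteField.pow_card (residue P.ring ⟨z, hz⟩)
  rw [← Nat.card_eq_fintype_card, Module.natCard_eq_pow_finrank (K := k), ← map_pow, ← sub_eq_zero,
    ← map_sub] at h
  have := (P.abv_coe_lt_one_iff _).2 ((residue_eq_zero_iff _).1 h)
  exact this

theorem natDegree_X_pow_card_sub_X (k : Type*) [Field k] [Finite k] {r : ℕ} (hr : 1 ≤ r) :
    (X ^ Nat.card k ^ r - X : k[X]).natDegree = Nat.card k ^ r :=
  FiniteField.X_pow_card_sub_X_natDegree_eq k (Nat.one_lt_pow (by omega) Finite.one_lt_card)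

theorem adjoin_simple_inv {k F : Type*} [Field k] [Field F] [Algebra k F] (x : F) :
    k⟮x⁻¹⟯ = k⟮x⟯ := by
  apply le_antisymm
  · rw [IntermediateField.adjoin_simple_le_iff]
    exact inv_mem (IntermediateField.mem_adjoin_simple_self k x)
  · rw [IntermediateField.adjoin_simple_le_iff]
    simpa using inv_mem (IntermediateField.mem_adjoin_simple_self k x⁻¹)

theorem numPlaces_le [Finite k] {x : F} (hx : Transcendental k x) {r : ℕ} (hr : 1 ≤ r) :
    Finite {P : FFPlace k F // P.degree = r} ∧
      numPlaces k F r ≤ (Nat.card k ^ r + 1) * Module.finrank k⟮x⟯ F := by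
  have hnd := natDegree_X_pow_card_sub_X k hr
  have hpos : 0 < Nat.card k ^ r := pow_pos Finite.card_pos _
  have h1 := finite_zeros (transcendental_aeval hx (g := X ^ Nat.card k ^ r - X) (by omega))
  have h1' := h1.2.trans (finrank_adjoin_aeval_le (by omega))
  have h2 := finite_zeros (w := x⁻¹) (fun h' => hx (by simpa using h'.inv))
  rw [adjoin_simple_inv] at h2
  have hsub : {P : FFPlace k F | P.degree = r} ⊆
      {P | P.abv (aeval x (X ^ Nat.card k ^ r - X : k[X])) < 1} ∪ {P | P.abv x⁻¹ < 1} := by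
    intro P hP
    by_cases hxP : x ∈ P.ring
    · left
      have := P.abv_pow_card_sub_lt_one hxP
      rw [show P.degree = r from hP] at this
      simpa using this
    · right
      exact P.abv_lt_one_iff.2 ((P.ring.inv_mem_nonunits_iff).2 (Or.inr hxP))
  have hfin := (h1.1.union h2.1).subset hsub
  refine ⟨hfin, ?_⟩
  have h3 := (Set.ncard_le_ncard hsub (h1.1.union h2.1)).trans (Set.ncard_union_le _ _)
  have h4 : numPlaces k F r = {P : FFPlace k F | P.degree = r}.ncard := rfl
  rw [hnd] at h1'
  rw [h4, add_mul, one_mul]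
  omega

theorem finite_degree_le [Finite k] (b : ℕ) : {P : FFPlace k F | P.degree ≤ b}.Finite := by
  obtain ⟨x, hx, -⟩ := IsAlgFunctionField.exists_finite (k := k) (F := F)
  have : {P : FFPlace k F | P.degree ≤ b} ⊆ ⋃ r ∈ Finset.Icc 1 b, {P | P.degree = r} := by
    intro P hP
    have := P.degree_pos
    simp only [Set.mem_ofPred_eq] at hP
    simp
    omega
  refine Set.Finite.subset (Set.Finite.biUnion (Finset.finite_toSet _) fun r hr => ?_) this
  exact (numPlaces_le hx (Finset.mem_Icc.1 hr).1).1

theorem exists_degree_gt [Finite k] (b : ℕ) : ∃ P : FFPlace k F, b < P.degree := by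
  obtain ⟨x, hx, -⟩ := IsAlgFunctionField.exists_finite (k := k) (F := F)
  let g : k[X] := ∏ r ∈ Finset.Icc 1 (b + 1), (X ^ Nat.card k ^ r - X)
  have hne : ∀ r ∈ Finset.Icc 1 (b + 1), (X ^ Nat.card k ^ r - X : k[X]) ≠ 0 := by
    intro r hr h0
    have := natDegree_X_pow_card_sub_X k (Finset.mem_Icc.1 hr).1
    rw [h0] at this
    have := pow_pos (Finite.card_pos (α := k)) r
    rw [natDegree_zero] at *
    omega
  have hg : 0 < g.natDegree := by
    rw [Polynomial.natDegree_prod _ _ hne]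
    refine Finset.sum_pos (fun r hr => ?_) ⟨1, by simp⟩
    rw [natDegree_X_pow_card_sub_X k (Finset.mem_Icc.1 hr).1]
    exact pow_pos Finite.card_pos _
  have hg1 : (g + 1).natDegree = g.natDegree := by
    simpa using Polynomial.natDegree_add_C (p := g) (a := 1)
  obtain ⟨P, hP⟩ := exists_place_mem_nonunits (transcendental_aeval hx (g := g + 1) (by omega))
  refine ⟨P, ?_⟩
  by_contra! hb
  rw [← P.abv_lt_one_iff] at hP
  have hxP : x ∈ P.ring := by
    by_contra hx'
    rw [← P.abv_le_one_iff, not_le] at hx'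
    have h0 : g + 1 ≠ 0 := fun h => by rw [h, natDegree_zero] at hg1; omega
    rw [P.abv_aeval_of_one_lt hx' h0] at hP
    exact absurd hP (not_lt.2 (one_le_pow₀ hx'.le))
  have hlt : P.abv (aeval x g) < 1 := by
    have hm : P.degree ∈ Finset.Icc 1 (b + 1) := by
      have := P.degree_pos
      simp; omega
    rw [map_prod, map_prod, ← Finset.mul_prod_erase _ _ hm]
    have h1 := P.abv_pow_card_sub_lt_one hxP
    have h2 : ∏ r ∈ (Finset.Icc 1 (b + 1)).erase P.degree,
        P.abv (aeval x (X ^ Nat.card k ^ r - X : k[X])) ≤ 1 :=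
      Finset.prod_le_one (fun _ _ => P.abv.nonneg _) fun r _ =>
        P.abv_le_one_iff.2 (P.aeval_mem hxP _)
    refine lt_of_le_of_lt (mul_le_of_le_one_right (P.abv.nonneg _) h2) ?_
    simpa using h1
  have := P.abv_nonarch (aeval x (g + 1)) (-aeval x g)
  rw [map_neg_eq_map] at this
  simp only [map_add, map_one, add_neg_cancel_comm] at this hP
  exact absurd this (not_le.2 (max_lt hP hlt))

end PlaceCounting

section Riemann

theorem linearIndependent_pow_mul {k F ι : Type*} [Field k] [Field F] [Algebra k F]
    [Fintype ι] {x : F} (hx : Transcendental k x) {u : ι → F} (hu : LinearIndependent k⟮x⟯ u) {f : F}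
    (hf : f ≠ 0) (N : ℕ) :
    LinearIndependent k (fun p : Fin N × ι => x ^ (p.1 : ℕ) * f * u p.2) := by
  rw [Fintype.linearIndependent_iff]
  intro c hc
  have h1 : ∑ i, (∑ j, c (j, i) • AdjoinSimple.gen k x ^ (j : ℕ)) • u i = 0 := by
    apply mul_left_cancel₀ hf
    rw [mul_zero, ← hc, Fintype.sum_prod_type_right, Finset.mul_sum]
    refine Finset.sum_congr rfl fun i _ => ?_
    rw [Algebra.smul_def, map_sum, Finset.sum_mul, Finset.mul_sum]
    refine Finset.sum_congr rfl fun j _ => ?_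
    rw [Algebra.smul_def, Algebra.smul_def, map_mul, map_pow, AdjoinSimple.algebraMap_gen,
      ← IsScalarTower.algebraMap_apply]
    ring
  have h2 := Fintype.linearIndependent_iff.1 hu _ h1
  rintro ⟨j, i⟩
  let g : k[X] := ∑ j : Fin N, C (c (j, i)) * X ^ (j : ℕ)
  have hg : aeval x g = 0 := by
    have := congrArg (algebraMap k⟮x⟯ F) (h2 i)
    simpa [g, Algebra.smul_def] using this
  have hg0 : g = 0 := by
    by_contra h
    exact hx ⟨g, h, hg⟩
  have := congrArg (fun h => coeff h j) hg0
  simpa [g, coeff_X_pow, Fin.val_inj, eq_comm] using this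

variable {k F : Type*} [Field k] [Field F] [Algebra k F]

namespace FFDivisor

theorem degree_add (D E : FFDivisor k F) :
    FFDivisor.degree (D + E) = FFDivisor.degree D + FFDivisor.degree E :=
  Finsupp.sum_add_index' (by simp) (by intros; ring)

theorem degree_zero : FFDivisor.degree (0 : FFDivisor k F) = 0 := Finsupp.sum_zero_index

theorem degree_single (P : FFPlace k F) (n : ℤ) :
    FFDivisor.degree (Finsupp.single P n) = n * P.degree :=
  Finsupp.sum_single_index (by simp)

theorem degree_nsmul (m : ℕ) (D : FFDivisor k F) :
    FFDivisor.degree (m • D) = m * FFDivisor.degree D := by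
  induction m with
  | zero => simp [degree_zero]
  | succ m ih => rw [add_smul, one_smul, degree_add, ih]; push_cast; ring

variable [IsAlgFunctionField k F]

theorem mem_riemannRochSpace_iff {D : FFDivisor k F} {z : F} :
    z ∈ D.riemannRochSpace ↔ ∀ P, P.abv z ≤ 2 ^ D P := by
  constructor
  · intro h P
    obtain ⟨t, ht⟩ := P.exists_uniformizer
    exact (P.mul_uniformizer_zpow_mem_iff ht).1 (h P t ht)
  · intro h P t ht
    exact (P.mul_uniformizer_zpow_mem_iff ht).2 (h P)

theorem riemannRochSpace_mono {D E : FFDivisor k F} (h : D ≤ E) :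
    D.riemannRochSpace ≤ E.riemannRochSpace := fun z hz => by
  rw [mem_riemannRochSpace_iff] at *
  exact fun P => (hz P).trans (zpow_le_zpow_right₀ one_le_two (h P))

theorem finrank_riemannRochSpace_add_single (D : FFDivisor k F) (P : FFPlace k F)
    (hD : FiniteDimensional k D.riemannRochSpace) :
    FiniteDimensional k (FFDivisor.riemannRochSpace (D + Finsupp.single P 1)) ∧
      Module.finrank k (FFDivisor.riemannRochSpace (D + Finsupp.single P 1)) ≤
        Module.finrank k D.riemannRochSpace + P.degree := by
  obtain ⟨t, ht⟩ := P.exists_uniformizer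
  set E : FFDivisor k F := D + Finsupp.single P 1 with hE
  have hEP : E P = D P + 1 := by simp [hE]
  have ht0 : (t : F) ≠ 0 := by
    simpa using ((IsDiscreteValuationRing.irreducible_iff_uniformizer t).2 ht).ne_zero
  let φ : E.riemannRochSpace →ₗ[k] P.ring :=
    { toFun := fun z => ⟨z.1 * (t : F) ^ (E P), z.2 P t ht⟩
      map_add' := fun a b => Subtype.ext (add_mul _ _ _)
      map_smul' := fun c a => Subtype.ext (by
        change (c • a.1) * _ = algebraMap k F c * (a.1 * _)
        rw [Algebra.smul_def, mul_assoc]) }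
  let ψ : E.riemannRochSpace →ₗ[k] ResidueField P.ring :=
    (IsScalarTower.toAlgHom k P.ring (ResidueField P.ring)).toLinearMap ∘ₗ φ
  have hker : (LinearMap.ker ψ).map E.riemannRochSpace.subtype ≤ D.riemannRochSpace := by
    rintro _ ⟨z, hz, rfl⟩
    have h1 : residue P.ring (φ z) = 0 := hz
    rw [residue_eq_zero_iff, ← P.abv_coe_lt_one_iff] at h1
    change P.abv ((z : F) * (t : F) ^ (E P)) < 1 at h1
    rw [mem_riemannRochSpace_iff]
    intro Q
    by_cases hQ : Q = P
    · subst hQ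
      rw [map_mul, map_zpow₀, Q.abv_uniformizer ht, inv_zpow, ← div_eq_mul_inv,
        div_lt_one (by positivity), hEP] at h1
      by_cases hz0 : (z : F) = 0
      · simp only [Submodule.subtype_apply, hz0, map_zero]; positivity
      obtain ⟨a, ha⟩ := Q.exists_abv_eq_zpow hz0
      simp only [Submodule.subtype_apply]
      rw [ha] at h1 ⊢
      rw [zpow_lt_zpow_iff_right₀ one_lt_two] at h1
      exact zpow_le_zpow_right₀ one_le_two (by omega)
    · have := mem_riemannRochSpace_iff.1 z.2 Q
      have hEQ : E Q = D Q := by simp [hE, Ne.symm hQ]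
      rwa [hEQ] at this
  have hkf : FiniteDimensional k (LinearMap.ker ψ) := by
    have : FiniteDimensional k ((LinearMap.ker ψ).map E.riemannRochSpace.subtype) :=
      Submodule.finiteDimensional_of_le hker
    exact Module.Finite.equiv (Submodule.equivMapOfInjective _
      (Submodule.injective_subtype _) (LinearMap.ker ψ)).symm
  have hkr : Module.finrank k (LinearMap.ker ψ) ≤ Module.finrank k D.riemannRochSpace := by
    rw [(Submodule.equivMapOfInjective _
      (Submodule.injective_subtype E.riemannRochSpace) (LinearMap.ker ψ)).finrank_eq]
    exact Submodule.finrank_mono hker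
  have hq : FiniteDimensional k (E.riemannRochSpace ⧸ LinearMap.ker ψ) :=
    Module.Finite.equiv ψ.quotKerEquivRange.symm
  have hfin : FiniteDimensional k E.riemannRochSpace :=
    Module.Finite.of_submodule_quotient (LinearMap.ker ψ)
  refine ⟨hfin, ?_⟩
  have h := LinearMap.finrank_range_add_finrank_ker ψ
  have h2 : Module.finrank k (LinearMap.range ψ) ≤ P.degree := Submodule.finrank_le _
  omega

theorem finrank_riemannRochSpace_add (A : FFPlace k F →₀ ℕ) : ∀ (D : FFDivisor k F)
    (_ : FiniteDimensional k D.riemannRochSpace),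
    FiniteDimensional k (FFDivisor.riemannRochSpace (D + A.mapRange Nat.cast rfl)) ∧
      (Module.finrank k (FFDivisor.riemannRochSpace (D + A.mapRange Nat.cast rfl)) : ℤ) ≤
        Module.finrank k D.riemannRochSpace
          + FFDivisor.degree (k := k) (F := F) (A.mapRange Nat.cast rfl) := by
  induction A using Finsupp.induction_linear with
  | zero =>
    intro D hD
    rw [Finsupp.mapRange_zero, add_zero, degree_zero, add_zero]
    exact ⟨hD, le_rfl⟩
  | add f g hf hg =>
    intro D hD
    obtain ⟨h1, h2⟩ := hf D hD
    obtain ⟨h3, h4⟩ := hg _ h1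
    rw [Finsupp.mapRange_add (by simp), ← add_assoc, degree_add]
    exact ⟨h3, by linarith⟩
  | single P n =>
    induction n with
    | zero =>
      intro D hD
      rw [Finsupp.single_zero, Finsupp.mapRange_zero, add_zero, degree_zero, add_zero]
      exact ⟨hD, le_rfl⟩
    | succ n ih =>
      intro D hD
      obtain ⟨h1, h2⟩ := ih D hD
      obtain ⟨h3, h4⟩ := finrank_riemannRochSpace_add_single _ P h1
      have : (Finsupp.single P (n + 1)).mapRange (Nat.cast : ℕ → ℤ) rfl
          = (Finsupp.single P n).mapRange (Nat.cast : ℕ → ℤ) rfl + Finsupp.single P 1 := by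
        rw [Finsupp.mapRange_single, Finsupp.mapRange_single, Nat.cast_add, Nat.cast_one,
          Finsupp.single_add]
      rw [this, ← add_assoc, degree_add, degree_single]
      refine ⟨h3, ?_⟩
      have h4' : (Module.finrank k (FFDivisor.riemannRochSpace
        (D + (Finsupp.single P n).mapRange (Nat.cast : ℕ → ℤ) rfl + Finsupp.single P 1)) : ℤ) ≤ _ :=
        Int.ofNat_le.2 h4
      push_cast at h4'
      linarith

theorem finrank_riemannRochSpace_le_of_le {D E : FFDivisor k F} (h : D ≤ E)
    (hD : FiniteDimensional k D.riemannRochSpace) :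
    FiniteDimensional k E.riemannRochSpace ∧ (Module.finrank k E.riemannRochSpace : ℤ) ≤
      Module.finrank k D.riemannRochSpace + (E.degree - D.degree) := by
  let A : FFPlace k F →₀ ℕ := (E - D).mapRange Int.toNat rfl
  have hA : A.mapRange Nat.cast rfl = E - D := by
    ext P
    have : 0 ≤ E P - D P := sub_nonneg.2 (h P)
    simp [A, Int.toNat_of_nonneg this]
  have hdeg : FFDivisor.degree (E - D) = E.degree - D.degree := by
    have := degree_add (E - D) D
    rw [sub_add_cancel] at this
    linarith
  have := finrank_riemannRochSpace_add A D hD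
  rwa [hA, add_sub_cancel, hdeg] at this

theorem riemannRochSpace_zero_le (hk : ∀ y : F, IsAlgebraic k y → y ∈ (algebraMap k F).range) :
    (0 : FFDivisor k F).riemannRochSpace ≤ Submodule.span k {1} := by
  intro z hz
  rw [mem_riemannRochSpace_iff] at hz
  obtain ⟨c, rfl⟩ := hk z (isAlgebraic_of_forall_mem fun P => P.abv_le_one_iff.1 (by simpa using hz P))
  rw [Submodule.mem_span_singleton]
  exact ⟨c, by rw [Algebra.smul_def, mul_one]⟩

theorem finiteDimensional_riemannRochSpace
    (hk : ∀ y : F, IsAlgebraic k y → y ∈ (algebraMap k F).range) (D : FFDivisor k F) :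
    FiniteDimensional k D.riemannRochSpace := by
  have h0 : FiniteDimensional k (0 : FFDivisor k F).riemannRochSpace :=
    Submodule.finiteDimensional_of_le (riemannRochSpace_zero_le hk)
  have h1 := (finrank_riemannRochSpace_le_of_le (le_sup_right : (0 : FFDivisor k F) ≤ D ⊔ 0) h0).1
  exact Submodule.finiteDimensional_of_le (riemannRochSpace_mono (le_sup_left : D ≤ D ⊔ 0))

/-- The divisor of poles. -/
theorem exists_poleDivisor {h : F} (hh : Transcendental k h) :
    ∃ A : FFDivisor k F, 0 ≤ A ∧ (∀ P, P.abv h ≤ 2 ^ A P) ∧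
      (∀ P, 1 < P.abv h → P.abv h = 2 ^ A P) ∧ A.degree ≤ Module.finrank k⟮h⟯ F := by
  classical
  have h0 : h ≠ 0 := fun h0 => hh (h0 ▸ isAlgebraic_zero)
  choose a ha using fun P : FFPlace k F => P.exists_abv_eq_zpow h0
  have hinv : Transcendental k h⁻¹ := fun h' => hh (by simpa using h'.inv)
  have hiff : ∀ P : FFPlace k F, P.abv h⁻¹ < 1 ↔ 0 < a P := fun P => by
    rw [map_inv₀, inv_lt_one₀ (P.abv.pos h0), ha, one_lt_zpow_iff_right₀ one_lt_two]
  let A : FFDivisor k F := Finsupp.onFinset (finite_zeros hinv).1.toFinset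
    (fun P => max (a P) 0) (fun P hP => by
      simp only [Set.Finite.mem_toFinset, Set.mem_ofPred_eq, hiff]
      by_contra hc
      exact hP (max_eq_right (not_lt.1 hc)))
  have hA : ∀ P, A P = max (a P) 0 := fun P => rfl
  refine ⟨A, fun P => by rw [hA]; exact le_max_right _ _, fun P => ?_, fun P hP => ?_, ?_⟩
  · rw [ha, hA]; exact zpow_le_zpow_right₀ one_le_two (le_max_left _ _)
  · rw [ha, one_lt_zpow_iff_right₀ one_lt_two] at hP
    rw [ha, hA, max_eq_left hP.le]
  · rw [← adjoin_simple_inv]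
    refine A.degree_le_finrank (fun P => by rw [hA]; exact le_max_right _ _) hinv fun P hP => ?_
    have : 0 < a P := by
      by_contra hc
      exact (Finsupp.mem_support_iff.1 hP) (max_eq_right (not_lt.1 hc))
    rw [map_inv₀, ha, hA, max_eq_left this.le, zpow_neg]

theorem exists_mem_riemannRochSpace (u : F) :
    ∃ A : FFDivisor k F, 0 ≤ A ∧ u ∈ A.riemannRochSpace := by
  by_cases hu : IsAlgebraic k u
  · refine ⟨0, le_rfl, mem_riemannRochSpace_iff.2 fun P => ?_⟩
    simpa using P.abv_le_one_iff.2 (P.mem_of_isAlgebraic hu)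
  · obtain ⟨A, hA, h1, -⟩ := exists_poleDivisor hu
    exact ⟨A, hA, mem_riemannRochSpace_iff.2 h1⟩

theorem mul_mem_riemannRochSpace {D E : FFDivisor k F} {a b : F} (ha : a ∈ D.riemannRochSpace)
    (hb : b ∈ E.riemannRochSpace) : a * b ∈ FFDivisor.riemannRochSpace (D + E) := by
  rw [mem_riemannRochSpace_iff] at *
  intro P
  rw [map_mul, Finsupp.add_apply, zpow_add₀ two_ne_zero]
  exact mul_le_mul (ha P) (hb P) (P.abv.nonneg _) (by positivity)

/-- Every divisor lies below a divisor whose Riemann-Roch space contains the `x ^ j / f`,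
`j ≤ m + deg f`, and whose degree is at most `(m + deg f) [F : k(x)]`. -/
theorem exists_ge_forall_mem [Finite k] {x : F} (hx : Transcendental k x) (D : FFDivisor k F) :
    ∃ (N : ℕ) (f : F) (E : FFDivisor k F), f ≠ 0 ∧ D ≤ E ∧
      E.degree ≤ N * Module.finrank k⟮x⟯ F ∧
      ∀ j ≤ N, x ^ j * f ∈ E.riemannRochSpace := by
  classical
  obtain ⟨M, hM1, hM⟩ : ∃ M : ℕ, 1 ≤ M ∧ ∀ P, D P ≤ M := by
    obtain ⟨M, hM⟩ := (D.support.image D).bddAbove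
    refine ⟨M.toNat + 1, by omega, fun P => ?_⟩
    by_cases hP : P ∈ D.support
    · have := hM (Finset.mem_coe.2 (Finset.mem_image_of_mem D hP))
      push_cast
      have := Int.self_le_toNat M
      linarith
    · rw [Finsupp.notMem_support_iff.1 hP]; positivity
  let g : k[X] := (X * ∏ P ∈ D.support, (X ^ Nat.card k ^ P.degree - X)) ^ M
  have hne : ∀ P ∈ D.support, (X ^ Nat.card k ^ P.degree - X : k[X]) ≠ 0 := fun P _ h0 => by
    have h1 := natDegree_X_pow_card_sub_X k P.degree_pos
    have h2 := pow_pos (Finite.card_pos (α := k)) P.degree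
    rw [h0, natDegree_zero] at h1
    omega
  have hne' : (X * ∏ P ∈ D.support, (X ^ Nat.card k ^ P.degree - X) : k[X]) ≠ 0 :=
    mul_ne_zero X_ne_zero (Finset.prod_ne_zero_iff.2 hne)
  have hg0 : g ≠ 0 := pow_ne_zero _ hne'
  have hg : 0 < g.natDegree := by
    rw [natDegree_pow, natDegree_mul X_ne_zero (Finset.prod_ne_zero_iff.2 hne), natDegree_X]
    positivity
  have htr := transcendental_aeval hx hg
  have htr' : Transcendental k (aeval x g)⁻¹ := fun h' => htr (by simpa using h'.inv)
  have hgx0 : aeval x g ≠ 0 := fun h0 => htr (h0 ▸ isAlgebraic_zero)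
  obtain ⟨A, hA0, hA1, hA2, hA3⟩ := exists_poleDivisor htr'
  obtain ⟨B, hB0, hB1, hB2, hB3⟩ := exists_poleDivisor hx
  refine ⟨M + g.natDegree, (aeval x g)⁻¹, A + M • B, inv_ne_zero hgx0, fun P => ?_, ?_, ?_⟩
  · have hAP := hA0 P
    have hBP := hB0 P
    simp only [Finsupp.coe_zero, Pi.zero_apply] at hAP hBP
    rw [Finsupp.add_apply, Finsupp.smul_apply, nsmul_eq_mul]
    by_cases hP : P ∈ D.support
    swap
    · rw [Finsupp.notMem_support_iff.1 hP]; positivity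
    by_cases hxP : 1 < P.abv x
    · have h1 := hB2 P hxP
      rw [h1, one_lt_zpow_iff_right₀ one_lt_two] at hxP
      have := hM P
      nlinarith
    · have hxP' := P.abv_le_one_iff.1 (not_lt.1 hxP)
      have hlt : P.abv (aeval x g) ≤ 2 ^ (-(M : ℤ)) := by
        rw [map_pow, map_pow, zpow_neg, zpow_natCast, ← inv_pow]
        refine pow_le_pow_left₀ (P.abv.nonneg _) ?_ _
        have h1 := P.abv_pow_card_sub_lt_one hxP'
        have h2 : aeval x (X ^ Nat.card k ^ P.degree - X : k[X]) ≠ 0 := by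
          intro h0
          refine hx ⟨_, hne P hP, h0⟩
        obtain ⟨a, ha⟩ := P.exists_abv_eq_zpow h2
        have h3 : P.abv (aeval x (X ^ Nat.card k ^ P.degree - X : k[X])) ≤ 2⁻¹ := by
          rw [ha, ← zpow_neg_one]
          have : P.abv (aeval x (X ^ Nat.card k ^ P.degree - X : k[X])) < 1 := by simpa using h1
          rw [ha, zpow_lt_one_iff_right₀ one_lt_two] at this
          exact zpow_le_zpow_right₀ one_le_two (by omega)
        rw [map_mul, map_mul, map_prod, map_prod, ← Finset.mul_prod_erase _ _ hP]
        refine (mul_le_of_le_one_left ?_ ?_).trans ((mul_le_of_le_one_right ?_ ?_).trans h3)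
        · exact mul_nonneg (P.abv.nonneg _) (Finset.prod_nonneg fun _ _ => P.abv.nonneg _)
        · simpa using not_lt.1 hxP
        · exact P.abv.nonneg _
        · exact Finset.prod_le_one (fun _ _ => P.abv.nonneg _) fun Q _ =>
            P.abv_le_one_iff.2 (P.aeval_mem hxP' _)
      have h4 : (2 : ℝ) ^ (M : ℤ) ≤ 2 ^ A P := by
        refine le_trans ?_ (hA1 P)
        rw [map_inv₀, le_inv_comm₀ (by positivity) (P.abv.pos hgx0), ← zpow_neg]
        exact hlt
      rw [zpow_le_zpow_iff_right₀ one_lt_two] at h4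
      have := hM P
      have : 0 ≤ (M : ℤ) * B P := by positivity
      linarith
  · rw [degree_add, degree_nsmul]
    rw [adjoin_simple_inv] at hA3
    have h1 := finrank_adjoin_aeval_le (x := x) hg
    have h2 : (Module.finrank k⟮aeval x g⟯ F : ℤ) ≤ g.natDegree * Module.finrank k⟮x⟯ F := by
      exact_mod_cast h1
    push_cast
    have : (M : ℤ) * B.degree ≤ M * Module.finrank k⟮x⟯ F :=
      mul_le_mul_of_nonneg_left hB3 (by positivity)
    linarith
  · intro j hj
    rw [mem_riemannRochSpace_iff]
    intro P
    have hAP := hA0 P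
    have hBP := hB0 P
    simp only [Finsupp.coe_zero, Pi.zero_apply] at hAP hBP
    rw [Finsupp.add_apply, Finsupp.smul_apply, nsmul_eq_mul, zpow_add₀ two_ne_zero, map_mul, map_pow]
    by_cases hxP : 1 < P.abv x
    · have h1 : (2 : ℝ) ^ ((M : ℤ) * B P) = P.abv x ^ M := by
        rw [hB2 P hxP, mul_comm, zpow_mul, zpow_natCast]
      rw [h1, map_inv₀, P.abv_aeval_of_one_lt hxP hg0]
      have h2 : P.abv x ^ j * (P.abv x ^ g.natDegree)⁻¹ ≤ P.abv x ^ M := by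
        rw [← div_eq_mul_inv, div_le_iff₀ (by positivity), ← pow_add]
        exact pow_le_pow_right₀ hxP.le hj
      refine h2.trans (le_mul_of_one_le_left (by positivity) ?_)
      exact one_le_zpow₀ one_le_two hAP
    · have h1 : P.abv x ^ j ≤ 1 := pow_le_one₀ (P.abv.nonneg _) (not_lt.1 hxP)
      refine (mul_le_of_le_one_left (P.abv.nonneg _) h1).trans ((hA1 P).trans ?_)
      refine le_mul_of_one_le_right (by positivity) (one_le_zpow₀ one_le_two (by positivity))

/-- Riemann's theorem. -/
theorem bddAbove_degree_sub_finrank [Finite k]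
    (hk : ∀ y : F, IsAlgebraic k y → y ∈ (algebraMap k F).range) :
    BddAbove {g : ℤ | ∃ D : FFDivisor k F,
      g = D.degree - (Module.finrank k D.riemannRochSpace : ℤ) + 1} := by
  obtain ⟨x, hx, hfin⟩ := IsAlgFunctionField.exists_finite (k := k) (F := F)
  let u := Module.finBasis k⟮x⟯ F
  choose A hA0 hA using fun i => exists_mem_riemannRochSpace (k := k) (u i)
  let C : FFDivisor k F := ∑ i, A i
  have hC : ∀ i, u i ∈ C.riemannRochSpace := fun i =>
    riemannRochSpace_mono (Finset.single_le_sum (fun j _ => hA0 j) (Finset.mem_univ i)) (hA i)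
  refine ⟨C.degree + 1, ?_⟩
  rintro _ ⟨D, rfl⟩
  obtain ⟨N, f, E, hf, hDE, hE, hmem⟩ := exists_ge_forall_mem hx D
  have hC0 : 0 ≤ C := Finset.sum_nonneg fun j _ => hA0 j
  have h1 := (finrank_riemannRochSpace_le_of_le (hDE.trans (le_add_of_nonneg_right hC0))
    (finiteDimensional_riemannRochSpace hk D)).2
  rw [degree_add] at h1
  have hfd := finiteDimensional_riemannRochSpace hk (E + C)
  have hli : LinearIndependent k (fun p : Fin (N + 1) × Fin (Module.finrank k⟮x⟯ F) =>
      (⟨x ^ (p.1 : ℕ) * f * u p.2, mul_mem_riemannRochSpace (hmem _ (Nat.lt_succ_iff.1 p.1.2)) (hC _)⟩ :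
        FFDivisor.riemannRochSpace (E + C))) := by
    apply LinearIndependent.of_comp (Submodule.subtype _)
    exact linearIndependent_pow_mul hx u.linearIndependent hf (N + 1)
  have h4 := hli.fintype_card_le_finrank
  simp only [Fintype.card_prod, Fintype.card_fin] at h4
  have h5 : ((N + 1 : ℤ) * Module.finrank k⟮x⟯ F) ≤
    Module.finrank k (FFDivisor.riemannRochSpace (E + C)) := by exact_mod_cast h4
  have h6 : (0 : ℤ) ≤ Module.finrank k⟮x⟯ F := by positivity
  linarith

end FFDivisor

end Riemann

section Extension

variable {k E L : Type*} [Field k] [Field E] [Field L] [Algebra k E] [Algebra k L] [Algebra E L]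
  [IsScalarTower k E L]

theorem finrank_adjoin_algebraMap [FiniteDimensional E L] {x : E} [FiniteDimensional k⟮x⟯ E] :
    FiniteDimensional k⟮algebraMap E L x⟯ L ∧
      Module.finrank k⟮algebraMap E L x⟯ L = Module.finrank k⟮x⟯ E * Module.finrank E L := by
  let ι : E →ₐ[k] L := IsScalarTower.toAlgHom k E L
  have hmap : k⟮x⟯.map ι = k⟮algebraMap E L x⟯ := by
    rw [IntermediateField.adjoin_map, Set.image_singleton]
    rfl
  let e : k⟮x⟯ ≃ₐ[k] k⟮algebraMap E L x⟯ :=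
    (k⟮x⟯.equivMap ι).trans (IntermediateField.equivOfEq hmap)
  have hfin : FiniteDimensional k⟮x⟯ L := FiniteDimensional.trans k⟮x⟯ E L
  constructor
  · let _ : Algebra k⟮x⟯ k⟮algebraMap E L x⟯ := e.toRingEquiv.toRingHom.toAlgebra
    have : IsScalarTower k⟮x⟯ k⟮algebraMap E L x⟯ L := IsScalarTower.of_algebraMap_eq fun a => rfl
    exact FiniteDimensional.right k⟮x⟯ k⟮algebraMap E L x⟯ L
  · rw [Module.finrank_mul_finrank]
    exact (Algebra.finrank_eq_of_equiv_equiv e.toRingEquiv (RingEquiv.refl L) (by ext; rfl)).symm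

theorem IsAlgFunctionField.of_finite [h : IsAlgFunctionField k E] [FiniteDimensional E L] :
    IsAlgFunctionField k L := by
  obtain ⟨x, hx, hfin⟩ := h.exists_finite
  refine ⟨algebraMap E L x, ?_, finrank_adjoin_algebraMap.1⟩
  rwa [transcendental_algebraMap_iff (algebraMap E L).injective]

namespace FFPlace

variable (E) in
/-- The place of `E` below a place of the algebraic extension `L`. -/
def restrict [Algebra.IsAlgebraic E L] (R : FFPlace k L) : FFPlace k E where
  ring := R.ring.comap (algebraMap E L)
  algebraMap_mem c := by
    rw [ValuationSubring.mem_comap, ← IsScalarTower.algebraMap_apply]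
    exact R.algebraMap_mem c
  ne_top h := by
    apply R.ne_top
    rw [eq_top_iff]
    intro z _
    have hE : ∀ a : E, algebraMap E L a ∈ R.ring := fun a => by
      have : a ∈ R.ring.comap (algebraMap E L) := h ▸ ValuationSubring.mem_top a
      exact this
    let R' : FFPlace E L := ⟨R.ring, hE, R.ne_top⟩
    exact R'.mem_of_isAlgebraic (Algebra.IsAlgebraic.isAlgebraic z)

variable [Algebra.IsAlgebraic E L]

theorem mem_restrict {R : FFPlace k L} {z : E} :
    z ∈ (R.restrict E).ring ↔ algebraMap E L z ∈ R.ring := Iff.rfl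

theorem mem_nonunits_restrict {R : FFPlace k L} {z : E} :
    z ∈ (R.restrict E).ring.nonunits ↔ algebraMap E L z ∈ R.ring.nonunits := by
  by_cases hz : z = 0
  · subst hz; simp
  have h1 := (R.restrict E).ring.inv_mem_nonunits_iff (x := z⁻¹)
  have h2 := R.ring.inv_mem_nonunits_iff (x := (algebraMap E L z)⁻¹)
  rw [inv_inv] at h1 h2
  rw [h1, h2, mem_restrict, map_inv₀]
  simp [hz]

theorem exists_restrict_eq (P : FFPlace k E) : ∃ R : FFPlace k L, R.restrict E = P := by
  let A : Subring L := P.ring.toSubring.map (algebraMap E L)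
  let f : P.ring →+* A := (algebraMap E L).restrict P.ring.toSubring A
    (fun z hz => Subring.mem_map.2 ⟨z, hz, rfl⟩)
  have hf : Function.Bijective f := by
    constructor
    · intro a b h
      exact Subtype.ext ((algebraMap E L).injective (congrArg Subtype.val h))
    · rintro ⟨_, z, hz, rfl⟩
      exact ⟨⟨z, hz⟩, rfl⟩
  let e : P.ring ≃+* A := RingEquiv.ofBijective f hf
  let I : Ideal A := (maximalIdeal P.ring).comap e.symm.toRingHom
  have hI : I ≠ ⊤ := Ideal.comap_ne_top _ (Ideal.IsPrime.ne_top inferInstance)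
  obtain ⟨B, hAB, hB⟩ := Ideal.image_subset_nonunits_valuationSubring I hI
  have hm : ∀ z, z ∈ P.ring.nonunits → algebraMap E L z ∈ B.nonunits := by
    intro z hz
    obtain ⟨h1, h2⟩ := ValuationSubring.mem_nonunits_iff_exists_mem_maximalIdeal.1 hz
    refine hB ⟨e ⟨z, h1⟩, ?_, rfl⟩
    change e.symm (e _) ∈ maximalIdeal P.ring
    rwa [e.symm_apply_apply]
  have hiff : ∀ z, algebraMap E L z ∈ B ↔ z ∈ P.ring := by
    intro z
    constructor
    · intro hz
      by_contra hzP
      have hz0 : z ≠ 0 := fun h0 => hzP (h0 ▸ zero_mem _)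
      have h1 := hm _ ((P.ring.inv_mem_nonunits_iff).2 (Or.inr hzP))
      rw [map_inv₀] at h1
      rcases (B.inv_mem_nonunits_iff).1 h1 with h2 | h2
      · exact hz0 (by simpa using h2)
      · exact h2 hz
    · intro hz
      exact hAB (Subring.mem_map.2 ⟨z, hz, rfl⟩)
  refine ⟨⟨B, fun c => ?_, fun h => ?_⟩, ?_⟩
  · rw [IsScalarTower.algebraMap_apply k E L, hiff]
    exact P.algebraMap_mem c
  · apply P.ne_top
    rw [eq_top_iff]
    intro z _
    rw [← hiff, h]
    exact ValuationSubring.mem_top _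
  · apply ext_ring
    ext z
    exact hiff z

/-- The inclusion of residue fields. -/
def residueMap (R : FFPlace k L) :
    ResidueField (R.restrict E).ring →ₐ[k] ResidueField R.ring :=
  let f : (R.restrict E).ring →+* R.ring :=
    (algebraMap E L).restrict (R.restrict E).ring.toSubring R.ring.toSubring (fun _ hz => hz)
  have hf : IsLocalHom f := ⟨fun a ha => by
    by_contra h
    have h1 := ValuationSubring.mem_nonunits_iff_exists_mem_maximalIdeal.2 ⟨a.2, (mem_maximalIdeal a).2 h⟩
    obtain ⟨h3, h4⟩ := ValuationSubring.mem_nonunits_iff_exists_mem_maximalIdeal.1 (mem_nonunits_restrict.1 h1)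
    exact (mem_maximalIdeal _).1 h4 ha⟩
  { ResidueField.map f with
    commutes' := fun c => by
      change residue R.ring _ = residue R.ring _
      congr 1
      apply Subtype.ext
      exact (IsScalarTower.algebraMap_apply k E L c).symm }

variable [IsAlgFunctionField k L]

theorem degree_restrict_le (R : FFPlace k L) : (R.restrict E).degree ≤ R.degree :=
  LinearMap.finrank_le_finrank_of_injective (f := (residueMap (E := E) R).toLinearMap)
    (residueMap R).injective

theorem degree_restrict_lt [IsAlgFunctionField k E] (R : FFPlace k L) {y : L} (hy : y ∈ R.ring)
    (h : ∀ a ∈ (R.restrict E).ring, ¬ R.abv (y - algebraMap E L a) < 1) :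
    (R.restrict E).degree < R.degree := by
  refine lt_of_le_of_ne R.degree_restrict_le fun heq => ?_
  have hs := (LinearMap.injective_iff_surjective_of_finrank_eq_finrank
    (f := (residueMap (E := E) R).toLinearMap) heq).1 (residueMap R).injective
  obtain ⟨a, ha⟩ := hs (residue _ ⟨y, hy⟩)
  obtain ⟨a, rfl⟩ := residue_surjective a
  have h1 : residue R.ring ⟨algebraMap E L a, a.2⟩ = residue _ ⟨y, hy⟩ := ha
  rw [eq_comm, ← sub_eq_zero, ← map_sub, residue_eq_zero_iff, ← R.abv_coe_lt_one_iff] at h1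
  exact h a a.2 h1

theorem degree_restrict_eq [IsAlgFunctionField k E] (R : FFPlace k L)
    (h : ∀ y ∈ R.ring, ∃ a ∈ (R.restrict E).ring, R.abv (y - algebraMap E L a) < 1) :
    (R.restrict E).degree = R.degree := by
  refine le_antisymm R.degree_restrict_le ?_
  refine LinearMap.finrank_le_finrank_of_surjective (f := (residueMap (E := E) R).toLinearMap) ?_
  intro y
  obtain ⟨y, rfl⟩ := residue_surjective y
  obtain ⟨a, ha, h1⟩ := h y y.2
  refine ⟨residue _ ⟨a, ha⟩, ?_⟩
  change residue R.ring ⟨algebraMap E L a, ha⟩ = residue _ y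
  rw [eq_comm, ← sub_eq_zero, ← map_sub, residue_eq_zero_iff, ← R.abv_coe_lt_one_iff]
  exact h1

theorem abv_lt_one_restrict [IsAlgFunctionField k E] {R : FFPlace k L} {z : E} :
    (R.restrict E).abv z < 1 ↔ R.abv (algebraMap E L z) < 1 := by
  rw [abv_lt_one_iff, abv_lt_one_iff, mem_nonunits_restrict]

end FFPlace

end Extension

section ArtinSchreier

theorem exists_natCast_of_pow_eq_self {K : Type*} [Field K] (p : ℕ) [Fact p.Prime] [CharP K p]
    {x : K} (hx : x ^ p = x) : ∃ n : ℕ, x = n := by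
  have h := (Subfield.mem_bot_iff_pow_eq_self K p).2 hx
  rw [← ZMod.fieldRange_castHom_eq_bot p] at h
  obtain ⟨c, rfl⟩ := h
  exact ⟨c.val, by simp⟩

/-- The difference operator `g(X + 1) - g(X)` lowers the degree by one. -/
theorem coeff_taylor_one_sub {K : Type*} [Field K] {g : K[X]} (hg : 0 < g.natDegree) :
    (taylor 1 g - g).coeff (g.natDegree - 1) = g.natDegree * g.leadingCoeff := by
  obtain ⟨d, hd⟩ : ∃ d, g.natDegree = d + 1 := ⟨g.natDegree - 1, by omega⟩
  rw [coeff_sub, taylor_coeff, leadingCoeff, hd, Nat.add_sub_cancel]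
  have h1 : (hasseDeriv d g).natDegree ≤ 1 := (natDegree_hasseDeriv_le g d).trans (by omega)
  rw [eval_eq_sum_range' (Nat.lt_succ_of_le h1), Finset.sum_range_succ, Finset.sum_range_one]
  simp only [hasseDeriv_coeff, one_pow, mul_one, zero_add, Nat.choose_self, Nat.cast_one, one_mul]
  rw [add_comm 1 d, Nat.choose_succ_self_right]
  ring

theorem natDegree_taylor_one_sub_lt {K : Type*} [Field K] {g : K[X]} (hg : 0 < g.natDegree) :
    (taylor 1 g - g).natDegree < g.natDegree := by
  have hg0 : g ≠ 0 := fun h => by simp [h] at hg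
  by_cases h : taylor 1 g - g = 0
  · rw [h, natDegree_zero]; exact hg
  · have := degree_sub_lt_left (degree_taylor g 1) (by rwa [Ne, taylor_eq_zero])
      (leadingCoeff_taylor 1 g)
    rw [degree_taylor] at this
    exact natDegree_lt_natDegree h this

theorem natDegree_X_pow_sub_X_sub_C {E : Type*} [Field E] {p : ℕ} [hp : Fact p.Prime] (f : E) :
    (X ^ p - X - C f : E[X]).natDegree = p ∧ (X ^ p - X - C f : E[X]).Monic := by
  have h1 : (X ^ p - X - C f : E[X]) = X ^ p - (X + C f) := by ring
  have hlt : (X + C f : E[X]).degree < p := by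
    refine (degree_X_add_C f).trans_lt ?_
    exact_mod_cast hp.out.one_lt
  rw [h1]
  exact ⟨by rw [natDegree_sub_eq_left_of_natDegree_lt] <;> simp [hp.out.one_lt],
    monic_X_pow_sub hlt⟩

variable {E L : Type*} [Field E] [Field L] [Algebra E L] {p : ℕ} [hp : Fact p.Prime]

/-- The data of an Artin-Schreier extension `L = E(y)`, `y ^ p - y = f`. -/
structure IsArtinSchreier (p : ℕ) (f : E) (y : L) : Prop where
  eq : y ^ p - y = algebraMap E L f
  notMem : y ∉ (algebraMap E L).range
  top : Algebra.adjoin E {y} = ⊤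

namespace IsArtinSchreier

variable {f : E} {y : L}

theorem isIntegral (h : IsArtinSchreier p f y) : IsIntegral E y := by
  refine ⟨_, (natDegree_X_pow_sub_X_sub_C (p := p) f).2, ?_⟩
  simp [h.eq]

theorem finite (h : IsArtinSchreier p f y) : FiniteDimensional E L :=
  (PowerBasis.ofAdjoinEqTop h.isIntegral h.top).finite

end IsArtinSchreier

variable [CharP E p]

theorem minpoly_artinSchreier {f : E} {y : L} (hy : y ^ p - y = algebraMap E L f)
    (hne : y ∉ (algebraMap E L).range) : minpoly E y = X ^ p - X - C f := by
  obtain ⟨hdeg, hmon⟩ := natDegree_X_pow_sub_X_sub_C (p := p) f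
  have hroot : aeval y (X ^ p - X - C f : E[X]) = 0 := by simp [hy]
  have hint : IsIntegral E y := ⟨_, hmon, by simpa [aeval_def] using hroot⟩
  have hdvd := minpoly.dvd E y hroot
  refine (eq_of_monic_of_dvd_of_natDegree_le (minpoly.monic hint) hmon hdvd ?_).symm
  rw [hdeg]
  by_contra! hlt
  apply hne
  let K := AlgebraicClosure L
  have : CharP K p := charP_of_injective_algebraMap (algebraMap E K).injective p
  let m : K[X] := (minpoly E y).map (algebraMap E K)
  have hsplit : m.Splits := IsAlgClosed.splits m
  have hm : m.Monic := (minpoly.monic hint).map _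
  have hroots : ∀ z ∈ m.roots, ∃ e : E, z = algebraMap L K y + algebraMap E K e := by
    intro z hz
    have h1 : aeval z (minpoly E y) = 0 := by
      have := (mem_roots'.1 hz).2
      rwa [IsRoot, eval_map_algebraMap] at this
    obtain ⟨q, hq⟩ := hdvd
    have h2 : aeval z (X ^ p - X - C f : E[X]) = 0 := by rw [hq, map_mul, h1, zero_mul]
    have h3 : z ^ p - z = algebraMap E K f := by simpa [sub_eq_zero] using h2
    have h4 : (algebraMap L K y) ^ p - algebraMap L K y = algebraMap E K f := by
      rw [← map_pow, ← map_sub, hy, ← IsScalarTower.algebraMap_apply]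
    obtain ⟨n, hn⟩ := exists_natCast_of_pow_eq_self p (x := z - algebraMap L K y) (by
      rw [sub_pow_char]; linear_combination h3 - h4)
    exact ⟨n, by rw [map_natCast, ← hn]; ring⟩
  have hsum : ∀ s : Multiset K, (∀ z ∈ s, ∃ e : E, z = algebraMap L K y + algebraMap E K e) →
      ∃ e : E, s.sum = s.card * algebraMap L K y + algebraMap E K e := by
    intro s
    induction s using Multiset.induction with
    | empty => intro _; exact ⟨0, by simp⟩
    | cons a s ih =>
      intro h
      obtain ⟨e, he⟩ := ih fun z hz => h z (Multiset.mem_cons_of_mem hz)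
      obtain ⟨e', he'⟩ := h a (Multiset.mem_cons_self a s)
      refine ⟨e + e', ?_⟩
      rw [Multiset.sum_cons, he, he', Multiset.card_cons, map_add]
      push_cast
      ring
  obtain ⟨e, he⟩ := hsum _ hroots
  rw [← hsplit.natDegree_eq_card_roots, natDegree_map] at he
  have h5 := hsplit.nextCoeff_eq_neg_sum_roots_of_monic hm
  rw [nextCoeff_map (algebraMap E K).injective, he] at h5
  set d := (minpoly E y).natDegree with hd
  have hdpos : 0 < d := minpoly.natDegree_pos hint
  have hd0 : (d : E) ≠ 0 := by
    rw [Ne, CharP.cast_eq_zero_iff E p]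
    exact Nat.not_dvd_of_pos_of_lt hdpos hlt
  refine ⟨(-(minpoly E y).nextCoeff - e) / d, ?_⟩
  apply (algebraMap L K).injective
  rw [← IsScalarTower.algebraMap_apply, map_div₀, map_natCast, map_sub, map_neg, h5]
  have hd0' : (d : K) ≠ 0 := by
    rw [← map_natCast (algebraMap E K)]
    exact (_root_.map_ne_zero _).2 hd0
  rw [div_eq_iff hd0']
  ring

namespace IsArtinSchreier

variable {f : E} {y : L}

theorem natDegree_minpoly (h : IsArtinSchreier p f y) : (minpoly E y).natDegree = p := by
  rw [minpoly_artinSchreier h.eq h.notMem, (natDegree_X_pow_sub_X_sub_C f).1]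

theorem finrank_eq (h : IsArtinSchreier p f y) : Module.finrank E L = p := by
  rw [(PowerBasis.ofAdjoinEqTop h.isIntegral h.top).finrank, PowerBasis.ofAdjoinEqTop_dim,
    h.natDegree_minpoly]

theorem isSeparable (h : IsArtinSchreier p f y) : Algebra.IsSeparable E L := by
  have hs : (minpoly E y).Separable := by
    rw [minpoly_artinSchreier h.eq h.notMem]
    have : derivative (X ^ p - X - C f : E[X]) = -1 := by
      simp [derivative_X_pow]
    rw [separable_def, this]
    exact isCoprime_one_right.neg_right
  have htop : E⟮y⟯ = ⊤ := by
    have := IntermediateField.adjoin_simple_toSubalgebra_of_isAlgebraic h.isIntegral.isAlgebraic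
    rw [h.top] at this
    exact IntermediateField.toSubalgebra_injective this
  have h2 : Algebra.IsSeparable E E⟮y⟯ :=
    (IntermediateField.isSeparable_adjoin_simple_iff_isSeparable E L).2 hs
  rw [htop] at h2
  exact Algebra.IsSeparable.of_algHom E (⊤ : IntermediateField E L) topEquiv.symm.toAlgHom

theorem exists_aeval (h : IsArtinSchreier p f y) (z : L) : ∃ g : E[X], g.natDegree < p ∧ z = aeval y g := by
  obtain ⟨g, hg, hz⟩ := (PowerBasis.ofAdjoinEqTop h.isIntegral h.top).exists_eq_aeval z
  rw [PowerBasis.ofAdjoinEqTop_dim, h.natDegree_minpoly] at hg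
  rw [PowerBasis.ofAdjoinEqTop_gen] at hz
  exact ⟨g, hg, hz⟩

theorem eq_zero_of_aeval_eq_zero (h : IsArtinSchreier p f y) {g : E[X]} (hg : g.natDegree < p) (h0 : aeval y g = 0) :
    g = 0 := by
  by_contra hne
  have := natDegree_le_of_dvd (minpoly.dvd E y h0) hne
  rw [h.natDegree_minpoly] at this
  omega

theorem exists_algEquiv (h : IsArtinSchreier p f y) : ∃ σ : L ≃ₐ[E] L, σ y = y + 1 := by
  have := h.finite
  have : CharP L p := charP_of_injective_algebraMap (algebraMap E L).injective p
  let pb := PowerBasis.ofAdjoinEqTop h.isIntegral h.top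
  have hgen : pb.gen = y := PowerBasis.ofAdjoinEqTop_gen _ _
  have hroot : aeval (y + 1) (minpoly E pb.gen) = 0 := by
    rw [hgen, minpoly_artinSchreier h.eq h.notMem]
    simp only [map_sub, map_pow, aeval_X, aeval_C, ← h.eq, add_pow_char, one_pow]
    ring
  let σ : L →ₐ[E] L := pb.lift (y + 1) hroot
  refine ⟨AlgEquiv.ofBijective σ (Algebra.IsAlgebraic.algHom_bijective σ), ?_⟩
  have := pb.lift_gen (y + 1) hroot
  rw [hgen] at this
  exact this

theorem aeval_taylor {σ : L ≃ₐ[E] L} (hσ : σ y = y + 1) (g : E[X]) :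
    aeval y (taylor 1 g - g) = σ (aeval y g) - aeval y g := by
  rw [map_sub, taylor_apply, aeval_comp]
  congr 1
  have := aeval_algHom_apply σ.toAlgHom y g
  change aeval (σ y) g = σ (aeval y g) at this
  rw [← this, hσ]
  simp

/-- The fixed field of the generator `y ↦ y + 1` is `E`. -/
theorem mem_range_of_fixed (h : IsArtinSchreier p f y) {σ : L ≃ₐ[E] L} (hσ : σ y = y + 1) {z : L} (hz : σ z = z) :
    z ∈ (algebraMap E L).range := by
  obtain ⟨g, hg, rfl⟩ := h.exists_aeval z
  by_cases hd : 0 < g.natDegree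
  · have h1 := aeval_taylor hσ g
    rw [hz, sub_self] at h1
    have h2 := h.eq_zero_of_aeval_eq_zero ((natDegree_taylor_one_sub_lt hd).trans hg) h1
    have h3 := coeff_taylor_one_sub hd
    rw [h2, coeff_zero, eq_comm, mul_eq_zero, CharP.cast_eq_zero_iff E p, leadingCoeff_eq_zero] at h3
    rcases h3 with h3 | h3
    · exact absurd h3 (Nat.not_dvd_of_pos_of_lt hd hg)
    · simp [h3] at hd
  · rw [eq_C_of_natDegree_eq_zero (by omega : g.natDegree = 0)]
    exact ⟨_, by simp; rfl⟩

end IsArtinSchreier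

end ArtinSchreier

section ArtinSchreierPlaces

set_option linter.unusedSectionVars false

variable {k E L : Type*} [Field k] [Field E] [Field L] [Algebra k E] [Algebra k L] [Algebra E L]
  [IsScalarTower k E L]

namespace FFPlace

/-- The place `{z | σ z ∈ 𝒪}`. -/
def conj (σ : L ≃ₐ[E] L) (R : FFPlace k L) : FFPlace k L where
  ring := R.ring.comap (σ : L →+* L)
  algebraMap_mem c := by
    have h1 : σ (algebraMap k L c) = algebraMap k L c := by
      rw [IsScalarTower.algebraMap_apply k E L, σ.commutes]
    rw [ValuationSubring.mem_comap]
    exact h1.symm ▸ R.algebraMap_mem c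
  ne_top h := by
    apply R.ne_top
    rw [eq_top_iff]
    intro z _
    have : σ.symm z ∈ R.ring.comap (σ : L →+* L) := h ▸ ValuationSubring.mem_top _
    simpa using this

theorem mem_conj {σ : L ≃ₐ[E] L} {R : FFPlace k L} {z : L} :
    z ∈ (R.conj σ).ring ↔ σ z ∈ R.ring := Iff.rfl

theorem restrict_conj [Algebra.IsAlgebraic E L] (σ : L ≃ₐ[E] L) (R : FFPlace k L) :
    (R.conj σ).restrict E = R.restrict E := by
  apply ext_ring
  ext z
  rw [mem_restrict, mem_restrict, mem_conj, σ.commutes]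

variable [IsAlgFunctionField k L]

theorem abv_conj_lt_one {σ : L ≃ₐ[E] L} {R : FFPlace k L} {z : L} :
    (R.conj σ).abv z < 1 ↔ R.abv (σ z) < 1 := by
  by_cases hz : z = 0
  · simp [hz]
  have hz' : σ z ≠ 0 := by simpa using hz
  rw [← not_iff_not, not_lt, not_lt, ← inv_le_one₀ ((R.conj σ).abv.pos hz),
    ← inv_le_one₀ (R.abv.pos hz'), ← map_inv₀, ← map_inv₀, abv_le_one_iff, abv_le_one_iff,
    mem_conj, map_inv₀]

end FFPlace

variable [IsAlgFunctionField k E] [IsAlgFunctionField k L]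
variable {p : ℕ} [hp : Fact p.Prime]

theorem FFPlace.abv_pow_sub_self {F : Type*} [Field F] [Algebra k F] [IsAlgFunctionField k F]
    (R : FFPlace k F) {z : F} (hz : 1 < R.abv z) : R.abv (z ^ p - z) = R.abv z ^ p := by
  rw [sub_eq_add_neg, R.abv_add_eq_left, map_pow]
  rw [map_neg_eq_map, map_pow]
  exact lt_self_pow₀ hz hp.out.one_lt

variable [CharP k p] [CharP E p] {f : E} {y : L}

namespace IsArtinSchreier

theorem mem_of_mem (h : IsArtinSchreier p f y) {R : FFPlace k L} (hf : algebraMap E L f ∈ R.ring) :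
    y ∈ R.ring := by
  by_contra hy
  rw [← R.abv_le_one_iff, not_le] at hy
  rw [← R.abv_le_one_iff, ← h.eq, R.abv_pow_sub_self hy] at hf
  exact absurd hf (not_le.2 (one_lt_pow₀ hy hp.out.ne_zero))

/-- The residue degree grows where `f` is not of the form `a ^ p - a` modulo the place. -/
theorem degree_restrict_lt [Algebra.IsAlgebraic E L] (h : IsArtinSchreier p f y)
    {R : FFPlace k L} (hf : f ∈ (R.restrict E).ring)
    (hP : ∀ a ∈ (R.restrict E).ring, ¬ (R.restrict E).abv (f - (a ^ p - a)) < 1) :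
    (R.restrict E).degree < R.degree := by
  have : CharP L p := charP_of_injective_algebraMap (algebraMap E L).injective p
  refine R.degree_restrict_lt (h.mem_of_mem hf) fun a ha hlt => hP a ha ?_
  rw [FFPlace.abv_lt_one_restrict, map_sub (algebraMap E L), map_sub (algebraMap E L),
    map_pow (algebraMap E L), ← h.eq]
  have h1 : y ^ p - y - ((algebraMap E L a) ^ p - algebraMap E L a)
      = (y - algebraMap E L a) ^ p + -(y - algebraMap E L a) := by
    rw [sub_pow_char]; ring
  rw [h1]
  refine (R.abv_nonarch _ _).trans_lt (max_lt ?_ ?_)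
  · rw [map_pow]
    exact pow_lt_one₀ (R.abv.nonneg _) hlt hp.out.ne_zero
  · rwa [map_neg_eq_map]

theorem exists_abv_sub_natCast_lt (h : IsArtinSchreier p f y) {R : FFPlace k L}
    (hf : R.abv (algebraMap E L f) < 1) : ∃ n : ℕ, R.abv (y - n) < 1 := by
  have hy := h.mem_of_mem (R.abv_le_one_iff.1 hf.le)
  have : CharP (ResidueField R.ring) p :=
    charP_of_injective_algebraMap (algebraMap k (ResidueField R.ring)).injective p
  obtain ⟨n, hn⟩ := exists_natCast_of_pow_eq_self p (x := residue R.ring ⟨y, hy⟩) (by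
    rw [← map_pow, ← sub_eq_zero, ← map_sub, residue_eq_zero_iff, ← R.abv_coe_lt_one_iff]
    change R.abv (y ^ p - y) < 1
    rwa [h.eq])
  refine ⟨n, ?_⟩
  rw [← map_natCast (residue R.ring), ← sub_eq_zero, ← map_sub, residue_eq_zero_iff,
    ← R.abv_coe_lt_one_iff] at hn
  simpa using hn

theorem pow_apply {σ : L ≃ₐ[E] L} (hσ : σ y = y + 1) (j : ℕ) : (σ ^ j) y = y + j := by
  induction j with
  | zero => simp
  | succ j ih => rw [pow_succ', AlgEquiv.mul_apply, ih, map_add, hσ, map_natCast]; push_cast; ring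

theorem pow_eq_one (h : IsArtinSchreier p f y) {σ : L ≃ₐ[E] L} (hσ : σ y = y + 1) : σ ^ p = 1 := by
  have : CharP L p := charP_of_injective_algebraMap (algebraMap E L).injective p
  ext z
  obtain ⟨g, -, rfl⟩ := h.exists_aeval z
  have := aeval_algHom_apply (σ ^ p).toAlgHom y g
  change aeval ((σ ^ p) y) g = (σ ^ p) (aeval y g) at this
  rw [← this, pow_apply hσ, CharP.cast_eq_zero, add_zero]
  rfl

theorem conj_injective (h : IsArtinSchreier p f y) {σ : L ≃ₐ[E] L} (hσ : σ y = y + 1)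
    {R : FFPlace k L} (hf : R.abv (algebraMap E L f) < 1) {i j : ℕ} (hi : i < p) (hj : j < p)
    (hij : R.conj (σ ^ i) = R.conj (σ ^ j)) : i = j := by
  obtain ⟨n, hn⟩ := h.exists_abv_sub_natCast_lt hf
  have key : ∀ i : ℕ, (R.conj (σ ^ i)).abv (y - n - i) < 1 := fun i => by
    rw [FFPlace.abv_conj_lt_one, map_sub (σ ^ i), map_sub (σ ^ i), pow_apply hσ, map_natCast, map_natCast]
    convert hn using 2
    ring
  have h1 := key i
  rw [hij] at h1
  have h2 := key j
  set S := R.conj (σ ^ j)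
  have h3 : S.abv (algebraMap k L ((i : k) - j)) < 1 := by
    have : algebraMap k L ((i : k) - j) = (y - n - j) + -(y - n - i) := by
      simp only [map_sub, map_natCast]; ring
    rw [this]
    refine (S.abv_nonarch _ _).trans_lt (max_lt h2 ?_)
    rwa [map_neg_eq_map]
  have h4 : (i : k) - j = 0 := by
    by_contra hne
    rw [S.abv_algebraMap hne] at h3
    exact lt_irrefl _ h3
  rw [sub_eq_zero, CharP.natCast_eq_natCast k p] at h4
  exact Nat.ModEq.eq_of_lt_of_lt h4 hi hj

/-- A place at which `f` vanishes splits completely. -/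
theorem degree_restrict_eq [Algebra.IsAlgebraic E L] (h : IsArtinSchreier p f y) {R : FFPlace k L}
    (hf : (R.restrict E).abv f < 1) : (R.restrict E).degree = R.degree := by
  classical
  rw [FFPlace.abv_lt_one_restrict] at hf
  obtain ⟨σ, hσ⟩ := h.exists_algEquiv
  refine R.degree_restrict_eq fun z hz => ?_
  obtain ⟨w, hw⟩ := FFPlace.exists_forall_abv_sub_lt
    ((Finset.range p).image fun j => R.conj (σ ^ j))
    (fun S => if S = R.conj (σ ^ 0) then z else 0) one_pos
  have hw0 : R.abv (w - z) < 1 := by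
    have := hw (R.conj (σ ^ 0)) (Finset.mem_image_of_mem _ (Finset.mem_range.2 hp.out.pos))
    rw [if_pos rfl, FFPlace.abv_conj_lt_one] at this
    simpa using this
  have hwj : ∀ j, j + 1 < p → R.abv ((σ ^ (j + 1)) w) < 1 := fun j hj => by
    have := hw (R.conj (σ ^ (j + 1))) (Finset.mem_image_of_mem _ (Finset.mem_range.2 hj))
    rw [if_neg, sub_zero, FFPlace.abv_conj_lt_one] at this
    · exact this
    · intro heq
      have := h.conj_injective hσ hf hj hp.out.pos heq
      omega
  obtain ⟨q, hq⟩ : ∃ q, p = q + 1 := ⟨p - 1, by have := hp.out.pos; omega⟩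
  let T := ∑ j ∈ Finset.range p, (σ ^ j) w
  have hT : σ T = T := by
    have h1 : σ T = ∑ j ∈ Finset.range p, (σ ^ (j + 1)) w := by
      rw [map_sum]
      exact Finset.sum_congr rfl fun j _ => by rw [pow_succ', AlgEquiv.mul_apply]
    have h2 := Finset.sum_range_succ (fun j => (σ ^ j) w) p
    rw [Finset.sum_range_succ', h.pow_eq_one hσ, pow_zero] at h2
    rw [h1]
    exact add_right_cancel h2
  obtain ⟨a, ha⟩ := h.mem_range_of_fixed hσ hT
  have hlt : R.abv (z - T) < 1 := by
    have h1 : T = w + ∑ j ∈ Finset.range q, (σ ^ (j + 1)) w := by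
      change ∑ j ∈ Finset.range p, (σ ^ j) w = _
      rw [hq, Finset.sum_range_succ', add_comm]
      simp
    have h2 : R.abv (∑ j ∈ Finset.range q, (σ ^ (j + 1)) w) < 1 :=
      Finset.sum_induction _ (fun z => R.abv z < 1)
        (fun a b ha hb => (R.abv_nonarch a b).trans_lt (max_lt ha hb)) (by simp)
        fun j hj => hwj j (by have := Finset.mem_range.1 hj; omega)
    have h3 : z - T = -((w - z) + ∑ j ∈ Finset.range q, (σ ^ (j + 1)) w) := by rw [h1]; ring
    rw [h3, map_neg_eq_map]
    exact (R.abv_nonarch _ _).trans_lt (max_lt hw0 h2)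
  refine ⟨a, ?_, by rwa [ha]⟩
  rw [FFPlace.mem_restrict, ha]
  have := sub_mem hz (R.abv_le_one_iff.1 hlt.le)
  simpa using this

theorem mul_numPlaces_le [Finite k] [Algebra.IsAlgebraic E L] (h : IsArtinSchreier p f y) {r : ℕ}
    (hr : 1 ≤ r) (hf : ∀ P : FFPlace k E, P.degree = r → P.abv f < 1) :
    p * numPlaces k E r ≤ numPlaces k L r := by
  obtain ⟨x, hx, -⟩ := IsAlgFunctionField.exists_finite (k := k) (F := L)
  have hfin := (numPlaces_le hx hr).1
  obtain ⟨σ, hσ⟩ := h.exists_algEquiv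
  choose R hR using fun P : FFPlace k E => FFPlace.exists_restrict_eq (L := L) P
  have hdeg : ∀ (P : FFPlace k E) (j : ℕ), P.degree = r → ((R P).conj (σ ^ j)).degree = r := by
    intro P j hP
    have h1 : ((R P).conj (σ ^ j)).restrict E = P := by rw [FFPlace.restrict_conj, hR]
    rw [← h.degree_restrict_eq (by rw [h1]; exact hf P hP), h1, hP]
  let φ : Fin p × {P : FFPlace k E // P.degree = r} → {R : FFPlace k L // R.degree = r} :=
    fun a => ⟨(R a.2).conj (σ ^ (a.1 : ℕ)), hdeg _ _ a.2.2⟩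
  have hφ : Function.Injective φ := by
    rintro ⟨i, P, hP⟩ ⟨j, Q, hQ⟩ hab
    have h1 : (R P).conj (σ ^ (i : ℕ)) = (R Q).conj (σ ^ (j : ℕ)) := congrArg Subtype.val hab
    have h2 := congrArg (FFPlace.restrict E) h1
    rw [FFPlace.restrict_conj, FFPlace.restrict_conj, hR, hR] at h2
    subst h2
    have h3 := hf P hP
    rw [← hR P, FFPlace.abv_lt_one_restrict] at h3
    have := h.conj_injective hσ h3 i.2 j.2 h1
    simp [Fin.ext_iff, this]
  have := Nat.card_le_card_of_injective φ hφ
  rwa [Nat.card_prod, Nat.card_fin] at this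

end IsArtinSchreier

end ArtinSchreierPlaces

section ArtinSchreierGenus

set_option linter.unusedSectionVars false

variable {k E L : Type*} [Field k] [Field E] [Field L] [Algebra k E] [Algebra k L] [Algebra E L]
  [IsScalarTower k E L] [IsAlgFunctionField k E] [IsAlgFunctionField k L]
  {p : ℕ} [hp : Fact p.Prime] [CharP E p] {f : E} {y : L}

theorem FFPlace.abv_pow_ne {Q : FFPlace k E} (a : E) : Q.abv a ^ p ≠ 2 ^ (p + 1) := by
  intro h
  have ha : a ≠ 0 := by
    rintro rfl
    rw [map_zero, zero_pow hp.out.ne_zero] at h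
    have : (0 : ℝ) < 2 ^ (p + 1) := by positivity
    linarith
  obtain ⟨m, hm⟩ := Q.exists_abv_eq_zpow ha
  rw [hm, ← zpow_natCast, ← zpow_natCast, ← zpow_mul] at h
  have h1 : m * p = (p + 1 : ℕ) := zpow_right_injective₀ two_pos (by norm_num) h
  have h2 : (p : ℤ) ∣ 1 := ⟨m - 1, by push_cast at h1; linarith⟩
  exact hp.out.one_lt.ne' (by exact_mod_cast Int.eq_one_of_dvd_one (by positivity) h2)

theorem notMem_range_of_abv_eq {Q : FFPlace k E} (hQ : Q.abv f = 2 ^ (p + 1))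
    (hy : y ^ p - y = algebraMap E L f) : y ∉ (algebraMap E L).range := by
  rintro ⟨a, rfl⟩
  have h1 : a ^ p - a = f := by
    apply (algebraMap E L).injective
    rw [map_sub, map_pow, hy]
  have h2 : 1 < Q.abv a := by
    by_contra! h
    have h3 : Q.abv f ≤ 1 := by
      rw [Q.abv_le_one_iff] at *
      rw [← h1]
      exact sub_mem (pow_mem h p) h
    rw [hQ] at h3
    exact absurd (one_lt_pow₀ one_lt_two (Nat.succ_ne_zero p)) (not_lt.2 h3)
  exact Q.abv_pow_ne (p := p) a (by rw [← Q.abv_pow_sub_self h2, h1, hQ])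

variable [Algebra.IsAlgebraic E L]

theorem FFPlace.abv_eq_one_restrict {R : FFPlace k L} {z : E} :
    (R.restrict E).abv z = 1 ↔ R.abv (algebraMap E L z) = 1 := by
  have h1 : (R.restrict E).abv z ≤ 1 ↔ R.abv (algebraMap E L z) ≤ 1 := by
    rw [abv_le_one_iff, abv_le_one_iff, mem_restrict]
  have h2 := abv_lt_one_restrict (R := R) (z := z)
  rw [le_antisymm_iff, le_antisymm_iff, h1, ← not_lt (b := (1 : ℝ)), h2, not_lt]

/-- The elements that are integral away from `Q` and have small poles above `Q`. -/
def IsNearlyIntegral (p : ℕ) (Q : FFPlace k E) (t : E) (z : L) : Prop :=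
  ∀ R : FFPlace k L, (R.restrict E ≠ Q → z ∈ R.ring) ∧
    (R.restrict E = Q → z ^ p * algebraMap E L t ∈ R.ring)

theorem IsNearlyIntegral.sub {Q : FFPlace k E} {t : E} {a b : L}
    (ha : IsNearlyIntegral p Q t a) (hb : IsNearlyIntegral p Q t b) :
    IsNearlyIntegral p Q t (a - b) := by
  have : CharP L p := charP_of_injective_algebraMap (algebraMap E L).injective p
  refine fun R => ⟨fun h => sub_mem ((ha R).1 h) ((hb R).1 h), fun h => ?_⟩
  rw [sub_pow_char, sub_mul]
  exact sub_mem ((ha R).2 h) ((hb R).2 h)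

theorem IsNearlyIntegral.map {Q : FFPlace k E} {t : E} {a : L}
    (ha : IsNearlyIntegral p Q t a) (σ : L ≃ₐ[E] L) : IsNearlyIntegral p Q t (σ a) := by
  intro R
  have h := ha (R.conj σ)
  rw [FFPlace.restrict_conj, FFPlace.mem_conj, FFPlace.mem_conj, map_mul, map_pow, σ.commutes] at h
  exact h

namespace IsArtinSchreier

variable {Q : FFPlace k E} {t : E}

theorem abv_pow_eq (h : IsArtinSchreier p f y) (hQ : Q.abv f = 2 ^ (p + 1)) (ht : Q.abv t = 2⁻¹)
    {R : FFPlace k L} (hR : R.restrict E = Q) :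
    R.abv (algebraMap E L t) < 1 ∧ 1 < R.abv y ∧
      R.abv y ^ p = R.abv (algebraMap E L f) ∧
      R.abv y ^ p * R.abv (algebraMap E L t) ^ (p + 1) = 1 := by
  have h1 : R.abv (algebraMap E L t) < 1 := by
    rw [← FFPlace.abv_lt_one_restrict, hR, ht]; norm_num
  have h2 : R.abv (algebraMap E L f) * R.abv (algebraMap E L t) ^ (p + 1) = 1 := by
    rw [← map_pow, ← map_mul, ← map_pow, ← map_mul, ← FFPlace.abv_eq_one_restrict, hR, map_mul,
      map_pow, hQ, ht, ← mul_pow]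
    norm_num
  have h3 : 1 < R.abv y := by
    by_contra! hy
    rw [R.abv_le_one_iff] at hy
    have h4 : algebraMap E L f ∈ R.ring := by
      rw [← h.eq]; exact sub_mem (pow_mem hy p) hy
    rw [← FFPlace.mem_restrict, hR, ← Q.abv_le_one_iff, hQ] at h4
    exact absurd (one_lt_pow₀ one_lt_two (Nat.succ_ne_zero p)) (not_lt.2 h4)
  have h5 : R.abv y ^ p = R.abv (algebraMap E L f) := by rw [← h.eq, R.abv_pow_sub_self h3]
  exact ⟨h1, h3, h5, by rw [h5, h2]⟩

theorem isAlgebraic_of_isNearlyIntegral_algebraMap (ht : Q.abv t = 2⁻¹) {a : E}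
    (ha : IsNearlyIntegral (L := L) p Q t (algebraMap E L a)) : IsAlgebraic k a := by
  refine isAlgebraic_of_forall_mem fun P => ?_
  obtain ⟨R, hR⟩ := FFPlace.exists_restrict_eq (L := L) P
  by_cases hP : P = Q
  · have h1 := (ha R).2 (hR.trans hP)
    rw [← map_pow, ← map_mul, ← FFPlace.mem_restrict, hR.trans hP, ← Q.abv_le_one_iff, map_mul,
      map_pow, ht] at h1
    rw [hP, ← Q.abv_le_one_iff]
    by_cases ha0 : a = 0
    · simp [ha0]
    obtain ⟨m, hm⟩ := Q.exists_abv_eq_zpow ha0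
    rw [hm, zpow_le_one_iff_right₀ one_lt_two]
    by_contra! hm0
    rw [hm] at h1
    have h2 : (2 : ℝ) ≤ 2 ^ m := by
      simpa using zpow_le_zpow_right₀ (one_le_two (α := ℝ)) (show (1 : ℤ) ≤ m by omega)
    have h3 : (2 : ℝ) ^ 2 ≤ (2 ^ m) ^ p :=
      (pow_le_pow_left₀ zero_le_two h2 2).trans
        (pow_le_pow_right₀ (one_le_two.trans h2) hp.out.two_le)
    linarith
  · rw [← hR, FFPlace.mem_restrict]
    exact (ha R).1 (by rwa [hR])

/-- Nearly integral elements are constant. -/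
theorem mem_range_of_isNearlyIntegral (h : IsArtinSchreier p f y)
    (hk : ∀ a : E, IsAlgebraic k a → a ∈ (algebraMap k E).range)
    (hQ : Q.abv f = 2 ^ (p + 1)) (ht : Q.abv t = 2⁻¹) {z : L} (hz : IsNearlyIntegral p Q t z) :
    z ∈ (algebraMap k L).range := by
  obtain ⟨σ, hσ⟩ := h.exists_algEquiv
  have key : ∀ (d : ℕ) (g : E[X]), g.natDegree = d → d < p →
      IsNearlyIntegral p Q t (aeval y g) → ∃ c : k, g = C (algebraMap k E c) := by
    intro d
    induction d using Nat.strong_induction_on with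
    | _ d ih =>
    intro g hg hd hz
    rcases Nat.eq_zero_or_pos d with rfl | hdpos
    · rw [eq_C_of_natDegree_eq_zero hg, aeval_C] at hz
      obtain ⟨c, hc⟩ := hk _ (isAlgebraic_of_isNearlyIntegral_algebraMap ht hz)
      exact ⟨c, by rw [hc]; exact eq_C_of_natDegree_eq_zero hg⟩
    exfalso
    rw [← hg] at hdpos hd
    have hlead : g.leadingCoeff ≠ 0 := by
      rw [Ne, leadingCoeff_eq_zero]; rintro rfl; simp at hdpos
    have hlt := natDegree_taylor_one_sub_lt hdpos
    obtain ⟨c, hc⟩ := ih _ (hg ▸ hlt) _ rfl (hlt.trans hd) (by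
      rw [aeval_taylor hσ]
      exact (hz.map σ).sub hz)
    have hcoeff := coeff_taylor_one_sub hdpos
    have hcne : (g.natDegree : E) * g.leadingCoeff ≠ 0 := by
      refine mul_ne_zero ?_ hlead
      rw [Ne, CharP.cast_eq_zero_iff E p]
      exact Nat.not_dvd_of_pos_of_lt hdpos hd
    rw [hc, coeff_C] at hcoeff
    have hone : g.natDegree = 1 := by
      by_contra hne
      rw [if_neg (by omega)] at hcoeff
      exact hcne hcoeff.symm
    rw [hone, if_pos rfl, Nat.cast_one, one_mul] at hcoeff
    have hg1 : g = C (algebraMap k E c) * X + C (g.coeff 0) := by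
      rw [hcoeff, leadingCoeff, hone]
      exact eq_X_add_C_of_natDegree_le_one hone.le
    have hc0 : c ≠ 0 := by rintro rfl; exact hlead (by rw [← hcoeff, map_zero])
    set a := g.coeff 0
    obtain ⟨R, hR⟩ := FFPlace.exists_restrict_eq (L := L) Q
    obtain ⟨ht1, hy1, hyf, hyt⟩ := h.abv_pow_eq hQ ht hR
    have hzR := (hz R).2 hR
    have hval : aeval y g = algebraMap k L c * y + algebraMap E L a := by
      rw [hg1]
      simp [← IsScalarTower.algebraMap_apply]
    rw [← R.abv_le_one_iff, map_mul, map_pow] at hzR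
    set τ := R.abv (algebraMap E L t)
    have hcy : R.abv (algebraMap k L c * y) = R.abv y := by
      rw [map_mul, R.abv_algebraMap hc0, one_mul]
    have hlt' : R.abv (aeval y g) < R.abv y := by
      by_contra! hge
      have hτ : 0 < τ := R.abv.pos (by
        intro h0
        have : τ = 0 := by simp only [τ, h0, map_zero]
        rw [this] at hyt
        simp at hyt)
      have h1 : R.abv y ^ p * τ ≤ 1 :=
        (mul_le_mul_of_nonneg_right (pow_le_pow_left₀ (R.abv.nonneg _) hge p) hτ.le).trans hzR
      have h2 : R.abv y ^ p * τ ^ (p + 1) < 1 := by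
        rw [pow_succ', ← mul_assoc]
        exact lt_of_le_of_lt (mul_le_of_le_one_left (by positivity) h1)
          (pow_lt_one₀ hτ.le ht1 hp.out.ne_zero)
      exact absurd hyt h2.ne
    have habs : R.abv (algebraMap E L a) = R.abv y := by
      have h1 : algebraMap E L a = -(algebraMap k L c * y + -aeval y g) := by rw [hval]; ring
      rw [h1, map_neg_eq_map, R.abv_add_eq_left, hcy]
      rwa [map_neg_eq_map, hcy]
    refine Q.abv_pow_ne (p := p) a ?_
    have hf0 : f ≠ 0 := by
      rintro rfl
      have : (0 : ℝ) < 2 ^ (p + 1) := by positivity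
      simp at hQ
      linarith
    have h3 : R.abv (algebraMap E L (a ^ p / f)) = 1 := by
      rw [map_div₀, map_div₀, map_pow, map_pow, habs, hyf, div_self]
      exact (R.abv.pos (by simpa using hf0)).ne'
    rw [← FFPlace.abv_eq_one_restrict, hR, map_div₀, map_pow, div_eq_one_iff_eq, hQ] at h3
    · exact h3
    · exact (Q.abv.pos hf0).ne'
  obtain ⟨g, hg, rfl⟩ := h.exists_aeval z
  obtain ⟨c, hc⟩ := key _ g rfl hg hz
  refine ⟨c, ?_⟩
  rw [hc, aeval_C, ← IsScalarTower.algebraMap_apply]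

theorem full_constants (h : IsArtinSchreier p f y)
    (hk : ∀ a : E, IsAlgebraic k a → a ∈ (algebraMap k E).range)
    (hQ : Q.abv f = 2 ^ (p + 1)) (z : L) (hz : IsAlgebraic k z) : z ∈ (algebraMap k L).range := by
  obtain ⟨t, ht⟩ := Q.exists_uniformizer
  refine h.mem_range_of_isNearlyIntegral hk hQ (Q.abv_uniformizer ht) fun R =>
    ⟨fun _ => R.mem_of_isAlgebraic hz, fun hR => ?_⟩
  refine mul_mem (pow_mem (R.mem_of_isAlgebraic hz) p) ?_
  rw [← FFPlace.mem_restrict, hR]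
  exact t.2

theorem degree_le_genus [Finite k] (h : IsArtinSchreier p f y)
    (hk : ∀ a : E, IsAlgebraic k a → a ∈ (algebraMap k E).range)
    (hQ : Q.abv f = 2 ^ (p + 1)) : (Q.degree : ℤ) ≤ ffGenus k L := by
  obtain ⟨t, ht⟩ := Q.exists_uniformizer
  have ht' := Q.abv_uniformizer ht
  obtain ⟨R, hR⟩ := FFPlace.exists_restrict_eq (L := L) Q
  obtain ⟨ht1, hy1, hyf, hyt⟩ := h.abv_pow_eq hQ ht' hR
  have hτp : 2 ^ p * R.abv (algebraMap E L t) ≤ 1 := by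
    have hτ0 : algebraMap E L (t : E) ≠ 0 := by
      intro h0
      rw [h0, map_zero] at hyt
      simp at hyt
    have hy0 : y ≠ 0 := by rintro rfl; simp at hy1; linarith
    obtain ⟨e, he⟩ := R.exists_abv_eq_zpow hτ0
    obtain ⟨m, hm⟩ := R.exists_abv_eq_zpow hy0
    rw [he, hm, ← zpow_natCast, ← zpow_natCast, ← zpow_mul, ← zpow_mul, ← zpow_add₀ two_ne_zero,
      ← zpow_zero (2 : ℝ)] at hyt
    have h1 : m * p + e * ((p + 1 : ℕ) : ℤ) = 0 := zpow_right_injective₀ two_pos (by norm_num) hyt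
    rw [he, zpow_lt_one_iff_right₀ one_lt_two] at ht1
    have h2 : (p : ℤ) ∣ -e := ⟨m + e, by push_cast at h1; linarith⟩
    have h3 := Int.le_of_dvd (by omega) h2
    rw [he, ← zpow_natCast, ← zpow_add₀ two_ne_zero]
    exact zpow_le_one_of_nonpos₀ one_le_two (by omega)
  set D : FFDivisor k L := Finsupp.single R 1 with hD
  have hspace : D.riemannRochSpace ≤ Submodule.span k {1} := by
    intro z hz
    rw [FFDivisor.mem_riemannRochSpace_iff] at hz
    have hz1 : ∀ S, S ≠ R → z ∈ S.ring := fun S hS => by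
      rw [← S.abv_le_one_iff]
      have := hz S
      rwa [hD, Finsupp.single_eq_of_ne hS, zpow_zero] at this
    obtain ⟨c, rfl⟩ := h.mem_range_of_isNearlyIntegral hk hQ ht' (z := z) fun S =>
      ⟨fun hS => hz1 S (by rintro rfl; exact hS hR), fun hS => by
        by_cases hSR : S = R
        · subst hSR
          have := hz S
          rw [hD, Finsupp.single_eq_same, zpow_one] at this
          rw [← S.abv_le_one_iff, map_mul, map_pow]
          exact (mul_le_mul_of_nonneg_right (pow_le_pow_left₀ (S.abv.nonneg _) this p)
            (S.abv.nonneg _)).trans hτp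
        · refine mul_mem (pow_mem (hz1 S hSR) p) ?_
          rw [← FFPlace.mem_restrict, hS]
          exact t.2⟩
    rw [Submodule.mem_span_singleton]
    exact ⟨c, by rw [Algebra.smul_def, mul_one]⟩
  have hrank : Module.finrank k D.riemannRochSpace ≤ 1 :=
    (Submodule.finrank_mono hspace).trans (finrank_span_singleton one_ne_zero).le
  have hle := le_csSup (FFDivisor.bddAbove_degree_sub_finrank (h.full_constants hk hQ)) ⟨D, rfl⟩
  have hdeg : D.degree = R.degree := by rw [hD, FFDivisor.degree_single, one_mul]
  have h4 := R.degree_restrict_le (E := E)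
  rw [hR] at h4
  rw [hdeg] at hle
  change _ ≤ ffGenus k L at hle
  have h5 : (Q.degree : ℤ) ≤ R.degree := by exact_mod_cast h4
  have h6 : (Module.finrank k D.riemannRochSpace : ℤ) ≤ 1 := by exact_mod_cast hrank
  linarith

end IsArtinSchreier

end ArtinSchreierGenus

section RationalFunctionField

variable {k F : Type*} [Field k] [Field F] [Algebra k F]

theorem exists_irreducible_natDegree_eq (k : Type*) [Field k] [Finite k] {r : ℕ} (hr : 1 ≤ r) :
    ∃ g : k[X], Irreducible g ∧ g.natDegree = r := by
  obtain ⟨p, hp⟩ := CharP.exists k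
  have : Fact p.Prime := ⟨CharP.char_is_prime k p⟩
  have : NeZero r := ⟨by omega⟩
  obtain ⟨α, hα⟩ := Field.exists_primitive_element k (FiniteField.Extension k p r)
  have hint : IsIntegral k α := Algebra.IsIntegral.isIntegral α
  refine ⟨minpoly k α, minpoly.irreducible hint, ?_⟩
  rw [← IntermediateField.adjoin.finrank hint, hα, IntermediateField.finrank_top',
    FiniteField.finrank_extension]

variable [IsAlgFunctionField k F]

theorem exists_degree_eq_natDegree {x : F} (hx : Transcendental k x)
    (hfin : Module.finrank k⟮x⟯ F = 1) {g : k[X]} (hg : Irreducible g) :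
    ∃ P : FFPlace k F, P.degree = g.natDegree := by
  have htr := transcendental_aeval hx hg.natDegree_pos
  obtain ⟨P, hP⟩ := exists_place_mem_nonunits htr
  rw [← P.abv_lt_one_iff] at hP
  refine ⟨P, le_antisymm ?_ ?_⟩
  · have h1 := sum_degree_le_finrank htr {P} (by simpa using hP)
    have h2 := finrank_adjoin_aeval_le (x := x) hg.natDegree_pos
    rw [Finset.sum_singleton] at h1
    rw [hfin, mul_one] at h2
    exact h1.trans h2
  · have hxP : x ∈ P.ring := by
      by_contra hx'
      rw [← P.abv_le_one_iff, not_le] at hx'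
      rw [P.abv_aeval_of_one_lt hx' hg.ne_zero] at hP
      exact absurd hP (not_lt.2 (one_le_pow₀ hx'.le))
    let ξ : ResidueField P.ring := residue P.ring ⟨x, hxP⟩
    have hξ : aeval ξ g = 0 := by
      have h1 : aeval ξ g = residue P.ring (aeval (⟨x, hxP⟩ : P.ring) g) :=
        aeval_algebraMap_apply (ResidueField P.ring) (⟨x, hxP⟩ : P.ring) g
      rw [h1, residue_eq_zero_iff, ← P.abv_coe_lt_one_iff]
      have h2 : aeval x g = ((aeval (⟨x, hxP⟩ : P.ring) g : P.ring) : F) :=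
        aeval_algebraMap_apply F (⟨x, hxP⟩ : P.ring) g
      rwa [← h2]
    have h3 := minpoly.eq_of_irreducible hg hξ
    have h4 : (minpoly k ξ).natDegree = g.natDegree := by
      rw [← h3, natDegree_mul_C (inv_ne_zero (leadingCoeff_ne_zero.2 hg.ne_zero))]
    rw [← h4]
    exact minpoly.natDegree_le ξ

theorem mem_range_of_isAlgebraic_of_degree_eq_one {P : FFPlace k F} (hP : P.degree = 1) {z : F}
    (hz : IsAlgebraic k z) : z ∈ (algebraMap k F).range := by
  have hzP := P.mem_of_isAlgebraic hz
  have hsurj : Function.Surjective (algebraMap k (ResidueField P.ring)) := by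
    have := (LinearMap.injective_iff_surjective_of_finrank_eq_finrank
      (f := (Algebra.ofId k (ResidueField P.ring)).toLinearMap)
      (by rw [Module.finrank_self]; exact hP.symm)).1
      (algebraMap k (ResidueField P.ring)).injective
    exact this
  obtain ⟨c, hc⟩ := hsurj (residue P.ring ⟨z, hzP⟩)
  refine ⟨c, ?_⟩
  have h1 : residue P.ring ⟨z - algebraMap k F c, sub_mem hzP (P.algebraMap_mem c)⟩ = 0 := by
    have : (⟨z - algebraMap k F c, sub_mem hzP (P.algebraMap_mem c)⟩ : P.ring)
      = ⟨z, hzP⟩ - algebraMap k P.ring c := rfl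
    rw [this, map_sub, ← hc, sub_eq_zero]
    rfl
  rw [residue_eq_zero_iff] at h1
  by_contra hne
  refine P.transcendental_of_mem_nonunits (z := z - algebraMap k F c)
    (sub_ne_zero.2 fun h => hne h.symm)
    (ValuationSubring.mem_nonunits_iff_exists_mem_maximalIdeal.2 ⟨_, h1⟩) ?_
  exact hz.sub (isAlgebraic_algebraMap c)

end RationalFunctionField

theorem rationalFunctionField {k Ω : Type*} [Field k] [Finite k] [Field Ω] [Algebra k Ω] {x : Ω}
    (hx : Transcendental k x) :
    IsFunctionFieldOver k k⟮x⟯ ∧ (∃ y : k⟮x⟯, Transcendental k y ∧ Module.finrank k⟮y⟯ k⟮x⟯ = 1) ∧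
      ∀ r, 1 ≤ r → 0 < numPlaces k k⟮x⟯ r := by
  set y := AdjoinSimple.gen k x
  have hy : Transcendental k y := by
    rw [← transcendental_algebraMap_iff (S := k⟮x⟯) (A := Ω) Subtype.val_injective]
    exact hx
  have htop : k⟮y⟯ = ⊤ := by
    apply IntermediateField.map_injective k⟮x⟯.val
    rw [IntermediateField.adjoin_map, Set.image_singleton, ← AlgHom.fieldRange_eq_map,
      IntermediateField.fieldRange_val]
    rfl
  have hfr : Module.finrank k⟮y⟯ k⟮x⟯ = 1 := by
    rw [htop]; exact IntermediateField.finrank_top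
  have hfd : FiniteDimensional k⟮y⟯ k⟮x⟯ := Module.finite_of_finrank_pos (by omega)
  have : IsAlgFunctionField k k⟮x⟯ := ⟨y, hy, hfd⟩
  have hpl : ∀ r, 1 ≤ r → ∃ P : FFPlace k k⟮x⟯, P.degree = r := by
    intro r hr
    obtain ⟨g, hg, rfl⟩ := exists_irreducible_natDegree_eq k hr
    exact exists_degree_eq_natDegree hy hfr hg
  obtain ⟨P, hP⟩ := hpl 1 le_rfl
  refine ⟨⟨⟨y, hy, hfd⟩, fun z hz => mem_range_of_isAlgebraic_of_degree_eq_one hP hz⟩,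
    ⟨y, hy, hfr⟩, fun r hr => ?_⟩
  obtain ⟨P, hP⟩ := hpl r hr
  have := (numPlaces_le hy hr).1
  have : Nonempty {P : FFPlace k k⟮x⟯ // P.degree = r} := ⟨⟨P, hP⟩⟩
  exact Nat.card_pos

section Step

variable {k E : Type*} [Field k] [Finite k] [Field E] [Algebra k E] [IsAlgFunctionField k E]
  {p : ℕ} [hp : Fact p.Prime]

theorem FFPlace.exists_forall_not_abv_lt (P : FFPlace k E) :
    ∃ c ∈ P.ring, ∀ a ∈ P.ring, ¬ P.abv (c - (a ^ p - a)) < 1 := by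
  have hfin : Finite (ResidueField P.ring) := Module.finite_of_finite k
  have hns : ¬ Function.Surjective (fun a : ResidueField P.ring => a ^ p - a) := by
    rw [← Finite.injective_iff_surjective]
    intro hinj
    exact zero_ne_one (hinj (a₁ := 0) (a₂ := 1) (by simp [hp.out.ne_zero]))
  rw [Function.Surjective] at hns
  push Not at hns
  obtain ⟨c, hc⟩ := hns
  obtain ⟨⟨c, hcP⟩, rfl⟩ := residue_surjective c
  refine ⟨c, hcP, fun a ha hlt => hc (residue P.ring ⟨a, ha⟩) ?_⟩
  rw [eq_comm, ← map_pow, ← map_sub, ← sub_eq_zero, ← map_sub, residue_eq_zero_iff,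
    ← P.abv_coe_lt_one_iff]
  exact hlt

theorem exists_artinSchreier_constant {N : Set ℕ} (hN : N.Finite) (n : ℕ) :
    ∃ (f : E) (Q : FFPlace k E), n ≤ Q.degree ∧ Q.abv f = 2 ^ (p + 1) ∧
      (∀ P : FFPlace k E, P.degree ∈ N → P.abv f < 1) ∧
      (∀ P : FFPlace k E, P.degree ≤ n → P.degree ∉ N → f ∈ P.ring ∧
        ∀ a ∈ P.ring, ¬ P.abv (f - (a ^ p - a)) < 1) := by
  classical
  obtain ⟨b, hb⟩ := hN.bddAbove
  obtain ⟨Q, hQ⟩ := exists_degree_gt (k := k) (F := E) (max b n)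
  have hS := finite_degree_le (k := k) (F := E) (max b n)
  obtain ⟨t, ht⟩ := Q.exists_uniformizer
  choose c hc hc' using fun P : FFPlace k E => P.exists_forall_not_abv_lt (p := p)
  obtain ⟨f, hf⟩ := FFPlace.exists_forall_abv_sub_lt (insert Q hS.toFinset)
    (fun P => if P = Q then ((t : E) ^ (p + 1))⁻¹ else if P.degree ∈ N then 0 else c P) one_pos
  have hQs : Q.abv (((t : E) ^ (p + 1))⁻¹) = 2 ^ (p + 1) := by
    rw [map_inv₀, map_pow, Q.abv_uniformizer ht, inv_pow, inv_inv]
  have hPQ : ∀ P : FFPlace k E, P.degree ≤ max b n → P ≠ Q := by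
    rintro P hP rfl
    omega
  refine ⟨f, Q, by omega, ?_, ?_, ?_⟩
  · have h1 := hf Q (Finset.mem_insert_self _ _)
    rw [if_pos rfl] at h1
    have h2 := Q.abv_add_eq_left (a := ((t : E) ^ (p + 1))⁻¹) (b := f - ((t : E) ^ (p + 1))⁻¹) (by
      rw [hQs]
      exact h1.trans (one_lt_pow₀ one_lt_two (Nat.succ_ne_zero p)))
    rwa [add_sub_cancel, hQs] at h2
  · intro P hP
    have hle : P.degree ≤ max b n := le_max_of_le_left (hb hP)
    have h1 := hf P (Finset.mem_insert_of_mem (by simpa using hle))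
    rwa [if_neg (hPQ P hle), if_pos hP, sub_zero] at h1
  · intro P hPn hP
    have hle : P.degree ≤ max b n := le_max_of_le_right hPn
    have h1 := hf P (Finset.mem_insert_of_mem (by simpa using hle))
    rw [if_neg (hPQ P hle), if_neg hP] at h1
    constructor
    · simpa using add_mem (P.abv_le_one_iff.1 h1.le) (hc P)
    · intro a ha hlt
      refine hc' P a ha ?_
      have : c P - (a ^ p - a) = (f - (a ^ p - a)) + -(f - c P) := by ring
      rw [this]
      refine (P.abv_nonarch _ _).trans_lt (max_lt hlt ?_)
      rwa [map_neg_eq_map]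

end Step

/-- One step of the tower. -/
theorem exists_extension {k Ω : Type*} [Field k] [Finite k] [Field Ω] [Algebra k Ω] [IsAlgClosed Ω]
    {p : ℕ} [hp : Fact p.Prime] [CharP k p] {N : Set ℕ} (hN : N.Finite) (hN1 : ∀ r ∈ N, 1 ≤ r)
    (n : ℕ) (E : IntermediateField k Ω) (hE : IsFunctionFieldOver k E) :
    ∃ (L : IntermediateField k Ω) (hlt : E < L), IsFunctionFieldOver k L ∧
      FiniteDimensional E (IntermediateField.extendScalars hlt.le) ∧
      Algebra.IsSeparable E (IntermediateField.extendScalars hlt.le) ∧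
      IntermediateField.relfinrank E L = p ∧
      (n : ℤ) ≤ ffGenus k L ∧
      (∀ m, (∃ x : E, Transcendental k x ∧ Module.finrank k⟮x⟯ E = m) →
        ∃ x : L, Transcendental k x ∧ Module.finrank k⟮x⟯ L = m * p) ∧
      (∀ r ∈ N, p * numPlaces k E r ≤ numPlaces k L r) ∧
      ((∀ P : FFPlace k E, P.degree ∉ N → n ≤ P.degree) →
        ∀ R : FFPlace k L, R.degree ∉ N → n + 1 ≤ R.degree) := by
  have := hE.isAlgFunctionField
  have : CharP E p := charP_of_injective_algebraMap (algebraMap k E).injective p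
  obtain ⟨f, Q, hQn, hQ, hfN, hfn⟩ := exists_artinSchreier_constant (k := k) (E := E) (p := p) hN n
  obtain ⟨y, hy⟩ : ∃ y : Ω, y ^ p - y = algebraMap E Ω f := by
    obtain ⟨hd, -⟩ := natDegree_X_pow_sub_X_sub_C (p := p) (algebraMap E Ω f)
    obtain ⟨y, hy⟩ := IsAlgClosed.exists_root (X ^ p - X - C (algebraMap E Ω f)) (by
      intro h0
      rw [natDegree_eq_of_degree_eq_some h0] at hd
      exact hp.out.ne_zero hd.symm)
    exact ⟨y, by simpa [sub_eq_zero] using hy⟩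
  have hyE : y ∉ E := fun h => notMem_range_of_abv_eq (E := E) (L := E) hQ
    (y := ⟨y, h⟩) (Subtype.ext hy) ⟨⟨y, h⟩, rfl⟩
  have hint : IsIntegral E y := by
    refine ⟨_, (natDegree_X_pow_sub_X_sub_C (p := p) f).2, ?_⟩
    simp [hy]
  let L : IntermediateField k Ω := E⟮y⟯.restrictScalars k
  have hyL : y ∈ L := IntermediateField.mem_adjoin_simple_self E y
  have hle : E ≤ L := fun z hz => E⟮y⟯.algebraMap_mem ⟨z, hz⟩
  have hlt : E < L := lt_of_le_of_ne hle fun h => hyE (h ▸ hyL)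
  let _ : Algebra E L := (IntermediateField.inclusion hle).toAlgebra
  have : IsScalarTower k E L := IsScalarTower.of_algebraMap_eq fun _ => rfl
  have hAS : IsArtinSchreier p f (⟨y, hyL⟩ : L) := by
    refine ⟨Subtype.ext hy, ?_, ?_⟩
    · rintro ⟨a, ha⟩
      have : (a : Ω) = y := congrArg Subtype.val ha
      exact hyE (this ▸ a.2)
    · rw [eq_top_iff]
      rintro ⟨z, hz⟩ -
      have hz' : z ∈ E⟮y⟯.toSubalgebra := hz
      rw [IntermediateField.adjoin_simple_toSubalgebra_of_isAlgebraic hint.isAlgebraic,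
        Algebra.adjoin_singleton_eq_range_aeval] at hz'
      obtain ⟨g, hg⟩ := hz'
      rw [Algebra.adjoin_singleton_eq_range_aeval]
      refine ⟨g, Subtype.ext ?_⟩
      let ι : L →ₐ[E] Ω := { L.val with commutes' := fun _ => rfl }
      have := aeval_algHom_apply ι ⟨y, hyL⟩ g
      exact this.symm.trans hg
  have hfd := hAS.finite
  have hsep := hAS.isSeparable
  have : IsAlgFunctionField k L := IsAlgFunctionField.of_finite (E := E)
  refine ⟨L, hlt, ⟨IsAlgFunctionField.exists_finite, hAS.full_constants hE.full_constants hQ⟩,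
    ?_, ?_, ?_, ?_, ?_, ?_, ?_⟩
  · exact hfd
  · exact hsep
  · rw [IntermediateField.relfinrank_eq_finrank_of_le hle]
    exact hAS.finrank_eq
  · refine le_trans ?_ (hAS.degree_le_genus hE.full_constants hQ)
    exact_mod_cast hQn
  · rintro m ⟨x, hx, rfl⟩
    have := finiteDimensional_adjoin hx
    refine ⟨algebraMap E L x, ?_, ?_⟩
    · rwa [transcendental_algebraMap_iff (algebraMap E L).injective]
    · rw [finrank_adjoin_algebraMap.2, hAS.finrank_eq]
  · intro r hr
    exact hAS.mul_numPlaces_le (hN1 r hr) fun P hP => hfN P (hP ▸ hr)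
  · intro hmin R hR
    have hP : (R.restrict E).degree ∉ N := fun h => by
      rw [hAS.degree_restrict_eq (hfN _ h)] at h
      exact hR h
    have h1 := hmin _ hP
    by_cases h2 : (R.restrict E).degree ≤ n
    · obtain ⟨h3, h4⟩ := hfn _ h2 hP
      have := hAS.degree_restrict_lt h3 h4
      omega
    · have := R.degree_restrict_le (E := E)
      omega

theorem exists_tower_positiveParameters_eq {k Ω : Type*} [Field k] [Finite k] [Field Ω]
    [Algebra k Ω] [IsAlgClosed Ω] {x : Ω} (hx : Transcendental k x) {N : Set ℕ} (hN : N.Finite)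
    (hN1 : ∀ r ∈ N, 1 ≤ r) :
    ∃ T : FFTower k Ω, (∀ r : ℕ, 1 ≤ r → Tendsto (T.ratio r) atTop (𝓝 (T.nu r))) ∧
      T.positiveParameters = N := by
  obtain ⟨p, hpk⟩ := CharP.exists k
  have hp : Fact p.Prime := ⟨CharP.char_is_prime k p⟩
  have hp0 : (0 : ℝ) < p := by exact_mod_cast hp.out.pos
  obtain ⟨hE0, hdeg0, hpl0⟩ := rationalFunctionField hx
  choose next hlt hff hfin hsep hrel hgen hdeg hsplit hinert using
    fun (n : ℕ) (E : {E : IntermediateField k Ω // IsFunctionFieldOver k E}) =>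
      exists_extension (p := p) hN hN1 n E.1 E.2
  let e : ℕ → {E : IntermediateField k Ω // IsFunctionFieldOver k E} := fun n =>
    Nat.rec ⟨k⟮x⟯, hE0⟩ (fun n E => ⟨next n E, hff n E⟩) n
  have hgenus : Tendsto (fun n => ffGenus k (e n).1) atTop atTop := by
    rw [← tendsto_add_atTop_iff_nat 1]
    exact tendsto_atTop_mono (fun n => hgen n (e n)) tendsto_natCast_atTop_atTop
  let T : FFTower k Ω :=
    { field := fun n => (e n).1
      isFunctionField := fun n => (e n).2
      lt_succ := fun n => hlt n (e n)
      finite_step := fun n => hfin n (e n)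
      separable_step := fun n => hsep n (e n)
      genus_tendsto := hgenus }
  have hdegree : ∀ n, ∃ z : (e n).1, Transcendental k z ∧ Module.finrank k⟮z⟯ (e n).1 = p ^ n := by
    intro n
    induction n with
    | zero => rw [pow_zero]; exact hdeg0
    | succ n ih => rw [pow_succ]; exact hdeg n (e n) _ ih
  have hmono : Monotone fun n => (e n).1 := monotone_nat_of_le_succ fun n => (hlt n (e n)).le
  have hrelf : ∀ n, IntermediateField.relfinrank (e 0).1 (e n).1 = p ^ n := by
    intro n
    induction n with
    | zero => rw [pow_zero]; exact IntermediateField.relfinrank_self _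
    | succ n ih =>
      rw [← IntermediateField.relfinrank_mul_relfinrank (hmono (Nat.zero_le n))
        (hmono (Nat.le_succ n)), ih, pow_succ]
      congr 1
      exact hrel n (e n)
  have hlarge : ∀ n (P : FFPlace k (e n).1), P.degree ∉ N → n ≤ P.degree := by
    intro n
    induction n with
    | zero => exact fun _ _ => Nat.zero_le _
    | succ n ih => exact hinert n (e n) ih
  have hratio : ∀ r n, T.ratio r n = numPlaces k (e n).1 r / (p : ℝ) ^ n := by
    intro r n
    have : T.ratio r n = numPlaces k (e n).1 r / (IntermediateField.relfinrank (e 0).1 (e n).1 : ℝ) :=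
      rfl
    rw [this, hrelf]
    push_cast
    rfl
  have hin : ∀ r ∈ N, ∃ l : ℝ, 0 < l ∧ Tendsto (T.ratio r) atTop (𝓝 l) := by
    intro r hr
    have hm : Monotone (T.ratio r) := by
      refine monotone_nat_of_le_succ fun n => ?_
      rw [hratio, hratio, pow_succ', div_le_div_iff₀ (by positivity) (by positivity)]
      have h1 : (p : ℝ) * numPlaces k (e n).1 r ≤ numPlaces k (e (n + 1)).1 r := by
        exact_mod_cast hsplit n (e n) r hr
      have h2 := mul_le_mul_of_nonneg_right h1 (by positivity : (0 : ℝ) ≤ (p : ℝ) ^ n)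
      linarith
    have hb : BddAbove (Set.range (T.ratio r)) := by
      refine ⟨(Nat.card k ^ r + 1 : ℕ), ?_⟩
      rintro _ ⟨n, rfl⟩
      rw [hratio, div_le_iff₀ (by positivity)]
      obtain ⟨z, hz, hzn⟩ := hdegree n
      have := (e n).2.isAlgFunctionField
      have h1 := (numPlaces_le hz (hN1 r hr)).2
      rw [hzn] at h1
      exact_mod_cast h1
    refine ⟨_, ?_, tendsto_atTop_ciSup hm hb⟩
    refine lt_of_lt_of_le ?_ (le_ciSup hb 0)
    rw [hratio, pow_zero, div_one]
    exact_mod_cast hpl0 r (hN1 r hr)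
  have hout : ∀ r, r ∉ N → Tendsto (T.ratio r) atTop (𝓝 0) := by
    intro r hr
    refine tendsto_const_nhds.congr' ?_
    filter_upwards [eventually_gt_atTop r] with n hn
    have : IsEmpty {P : FFPlace k (e n).1 // P.degree = r} := ⟨fun ⟨P, hP⟩ => by
      have := hlarge n P (hP ▸ hr)
      omega⟩
    rw [hratio, numPlaces, Nat.card_of_isEmpty]
    simp
  refine ⟨T, fun r _ => ?_, ?_⟩
  · by_cases hr : r ∈ N
    · obtain ⟨l, -, hl⟩ := hin r hr
      rwa [FFTower.nu, hl.limUnder_eq]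
    · rw [FFTower.nu, (hout r hr).limUnder_eq]
      exact hout r hr
  · ext r
    constructor
    · rintro ⟨-, h⟩
      by_contra hr
      rw [FFTower.nu, (hout r hr).limUnder_eq] at h
      exact lt_irrefl _ h
    · intro hr
      obtain ⟨l, hl0, hl⟩ := hin r hr
      exact ⟨hN1 r hr, by rwa [FFTower.nu, hl.limUnder_eq]⟩

end

theorem corollary3p5 (q : ℕ) (hq : IsPrimePow q) (k : Type*) [Field k] [Finite k]
    (hk : Nat.card k = q ^ 2) (M : Set ℕ) :
    (∃ T : FFTower k (AlgebraicClosure (RatFunc k)),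
      (∀ r : ℕ, 1 ≤ r → Tendsto (T.ratio r) atTop (𝓝 (T.nu r))) ∧
      T.positiveParameters ∩ M = ∅) ∧
    (∀ N : Set ℕ, N.Finite → N ⊆ {r | 1 ≤ r} \ M →
      ∃ T : FFTower k (AlgebraicClosure (RatFunc k)),
        (∀ r : ℕ, 1 ≤ r → Tendsto (T.ratio r) atTop (𝓝 (T.nu r))) ∧
        T.positiveParameters = N) := by
  have hX : Transcendental k (algebraMap (RatFunc k) (AlgebraicClosure (RatFunc k)) RatFunc.X) := by
    rw [transcendental_algebraMap_iff (algebraMap (RatFunc k) _).injective]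
    exact RatFunc.transcendental_X
  constructor
  · obtain ⟨T, hT, hT0⟩ := exists_tower_positiveParameters_eq hX Set.finite_empty (by simp)
    exact ⟨T, hT, by rw [hT0, Set.empty_inter]⟩
  · intro N hN hNM
    exact exists_tower_positiveParameters_eq hX hN fun r hr => (hNM hr).1
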